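/- Let $n\ge 4$. Let $D_n$ be the Coxeter graph with vertices $\overline{1},1,2,\dots,n-1$, in which $1,2,\dots,n-1$ form a path (with $i$ joined to $i+1$), $\overline{1}$ is joined to $2$, and there are no other edges. Let $\mathrm{TL}(D_n)$ be the associative unital $\mathbb{Z}[\delta]$-algebra ($\delta$ an indeterminate) with generators $b_{\overline{1}},b_1,\dots,b_{n-1}$ and defining relations $b_i^2=\delta b_i$ for all $i$; $b_ib_j=b_jb_i$ if $i$ and $j$ are not joined in $D_n$; and $b_ib_jb_i=b_i$ if $i$ and $j$ are joined in $D_n$. Let the pair-free Temperley--Lieb algebra $\mathrm{PFTL}(D_n)$ be the quotient of $\mathrm{TL}(D_n)$ by the relation $b_1b_{\overline{1}}=0$. Then $\mathrm{PFTL}(D_n)$ is a cellular algebra over $\mathbb{Z}[\delta]$. Here an associative unital algebra $A$ over a commutative ring $R$ is called cellular if it has a cell datum $(\Lambda,M,C,*)$, that is: 1. $\Lambda$ is a poset, $M(\lambda)$ is a finite set for each $\lambda\in\Lambda$, and $C:\coprod_{\lambda\in\Lambda}M(\lambda)\times M(\lambda)\to A$ is injective with image an $R$-basis of $A$; write $C^{\lambda}_{S,T}=C(S,T)$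 for $S,T\in M(\lambda)$. 2. $*$ is an $R$-linear involutory anti-automorphism of $A$ with $(C^{\lambda}_{S,T})^*=C^{\lambda}_{T,S}$ for all $\lambda\in\Lambda$ and $S,T\in M(\lambda)$. 3. For all $\lambda\in\Lambda$, $S,T\in M(\lambda)$ and $a\in A$, $$aC^{\lambda}_{S,T}\equiv\sum_{S'\in M(\lambda)}r_a(S',S)\,C^{\lambda}_{S',T}\pmod{A(<\lambda)},$$ where $r_a(S',S)\in R$ is independent of $T$, and $A(<\lambda)$ is the $R$-submodule of $A$ generated by all $C^{\mu}_{S'',T''}$ with $\mu<\lambda$ and $S'',T''\in M(\mu)$. -/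

import Mathlib

open Polynomial

universe u v

/-- A cell datum `(Λ, M, C, *)` for an associative unital algebra `A` over a commutative ring
`R`. -/
structure CellDatum (R : Type u) (A : Type v) [CommRing R] [Ring A] [Algebra R A] where
  /-- the poset `Λ` -/
  Λ : Type v
  [order : PartialOrder Λ]
  /-- the finite sets `M(l)`, for `l ∈ Λ` -/
  M : Λ → Type v
  [fintype : ∀ l, Fintype (M l)]
  /-- the map `C : ∐ M(l) × M(l) → A`, injective with image an `R`-basis of `A` -/
  C : (Σ l, M l × M l) → A
  C_injective : Function.Injective C
  C_linearIndependent : LinearIndependent R C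
  C_span : Submodule.span R (Set.range C) = ⊤
  /-- the `R`-linear involutory anti-automorphism `*` -/
  star : A →ₗ[R] A
  star_star : ∀ a, star (star a) = a
  star_mul : ∀ a b, star (a * b) = star b * star a
  star_C : ∀ (l : Λ) (S T : M l), star (C ⟨l, S, T⟩) = C ⟨l, T, S⟩
  /-- multiplication modulo `A(< l)`; the coefficients `r S' S` do not depend on `T` -/
  mul_C : ∀ (a : A) (l : Λ), ∃ r : M l → M l → R, ∀ S T : M l,
    a * C ⟨l, S, T⟩ - ∑ S', r S' S • C ⟨l, S', T⟩ ∈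
      Submodule.span R {x : A | ∃ m : Λ, m < l ∧ ∃ S'' T'' : M m, x = C ⟨m, S'', T''⟩}

/-- An algebra is cellular if it admits a cell datum. -/
def IsCellular (R : Type u) (A : Type v) [CommRing R] [Ring A] [Algebra R A] : Prop :=
  Nonempty (CellDatum R A)

/-- The Coxeter graph of type `D_n`. The vertex `0` stands for `s_{1̄}`, the vertex `i ≥ 1` for
`s_i`: the vertices `1, …, n - 1` form a path, and `0` is joined to `2` only. -/
def coxeterGraphD (n : ℕ) : SimpleGraph (Fin n) :=
  SimpleGraph.fromRel fun i j =>
    (1 ≤ i.val ∧ j.val = i.val + 1) ∨ (i.val = 0 ∧ j.val = 2)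

/-- The defining relations of `TL(D_n)` over `ℤ[δ]`, where `δ = X`. -/
inductive TLD.Rel (n : ℕ) : FreeAlgebra ℤ[X] (Fin n) → FreeAlgebra ℤ[X] (Fin n) → Prop
  | sq (i : Fin n) :
      TLD.Rel n (FreeAlgebra.ι ℤ[X] i * FreeAlgebra.ι ℤ[X] i)
        ((X : ℤ[X]) • FreeAlgebra.ι ℤ[X] i)
  | comm (i j : Fin n) (h : ¬ (coxeterGraphD n).Adj i j) :
      TLD.Rel n (FreeAlgebra.ι ℤ[X] i * FreeAlgebra.ι ℤ[X] j)
        (FreeAlgebra.ι ℤ[X] j * FreeAlgebra.ι ℤ[X] i)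
  | braid (i j : Fin n) (h : (coxeterGraphD n).Adj i j) :
      TLD.Rel n (FreeAlgebra.ι ℤ[X] i * FreeAlgebra.ι ℤ[X] j * FreeAlgebra.ι ℤ[X] i)
        (FreeAlgebra.ι ℤ[X] i)

/-- The Temperley–Lieb algebra `TL(D_n)` over `ℤ[δ]`. -/
def TLD (n : ℕ) : Type := RingQuot (TLD.Rel n)

noncomputable instance (n : ℕ) : Ring (TLD n) :=
  inferInstanceAs (Ring (RingQuot (TLD.Rel n)))

noncomputable instance (n : ℕ) : Algebra ℤ[X] (TLD n) :=
  inferInstanceAs (Algebra ℤ[X] (RingQuot (TLD.Rel n)))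

/-- The quotient map from the free algebra onto `TL(D_n)`. -/
noncomputable def TLD.mk (n : ℕ) : FreeAlgebra ℤ[X] (Fin n) →ₐ[ℤ[X]] TLD n :=
  RingQuot.mkAlgHom ℤ[X] (TLD.Rel n)

/-- The generator `b_i` of `TL(D_n)`; `b_{1̄}` has index `0`. -/
noncomputable def TLD.b {n : ℕ} (i : Fin n) : TLD n :=
  TLD.mk n (FreeAlgebra.ι ℤ[X] i)

/-- The relation `b_1 b_{1̄} = 0`. -/
inductive PFTLD.Rel (n : ℕ) : TLD n → TLD n → Prop
  | pair (i j : Fin n) (hi : i.val = 1) (hj : j.val = 0) :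
      PFTLD.Rel n (TLD.b i * TLD.b j) 0

/-- The pair-free Temperley–Lieb algebra `PFTL(D_n)`: the quotient of `TL(D_n)` by the relation
`b_1 b_{1̄} = 0`. -/
def PFTLD (n : ℕ) : Type := RingQuot (PFTLD.Rel n)

noncomputable instance (n : ℕ) : Ring (PFTLD n) :=
  inferInstanceAs (Ring (RingQuot (PFTLD.Rel n)))

noncomputable instance (n : ℕ) : Algebra ℤ[X] (PFTLD n) :=
  inferInstanceAs (Algebra ℤ[X] (RingQuot (PFTLD.Rel n)))

/-! The subalgebras `level n` form a tower whose branching graph is an infinite graph of type D: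
`even` and `odd` are both joined to `pos 0`, and then `pos 0`, `pos 1`, ... form a ray. Walks of
length `n` from `even` to `v` index the half-diagrams with `rank v` through strands, so they play
the role of `M(v)`. Each pair `(n, v)` has a monomial `e n v`, and the basis element of two walks
`S`, `T` ending at `v` is `prod S * e n v * star (prod T)`. The order on vertices compares numbers
of through strands.

Spanning: sandwiching `level (n + 1)` by `b (n + 1)` lands in `level n * b (n + 1)` (`sandwich`), so
`e n v * x * e n v` is a scalar multiple of `e n v` up to fewer through strands (`e_sandwich`).
Together with `e n v * e (n + 1) v.up * e n v = e n v`, this shows by induction on the level that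
walks span the left ideal of `e n v` modulo fewer through strands (`mul_e_mem`). Expanding on both
sides of `e n v` gives a spanning set of the algebra, and expanding only on the left gives the
cellular multiplication rule.

Independence: diagrams act on functions on colourings of strands by `2 * d` colours with a
fixed-point-free involution, which acts as the decoration of the first strand. An undecorated circle
counts all colours, so `δ` becomes `2 * d`; a decorated circle counts fixed colours, which gives
`b_1 b_{1̄} = 0`. Walks are recovered from sufficiently generic colourings (`eq_of_read_lift`), so
in a linear relation a coefficient with the most through strands vanishes at `δ = 2 * d` for all
large `d`. A polynomial with infinitely many roots is zero. -/

namespace PairFree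

/-! ### The branching graph and its walks -/

/-- The vertices of the branching graph of the tower of pair-free Temperley–Lieb algebras: `pos t`
stands for `t + 1` through strands, `even` and `odd` for no through strand and the parity of the
number of decorations. -/
inductive Vertex : Type
  | even
  | odd
  | pos (t : ℕ)
  deriving DecidableEq

namespace Vertex

/-- The number of through strands. -/
def rank : Vertex → ℕ
  | even => 0
  | odd => 0
  | pos t => t + 1

/-- The first level of the tower at which a vertex occurs. -/
def base : Vertex → ℕ
  | even => 0
  | odd => 2
  | pos t => t + 1

/-- The neighbour with one more through strand. -/
def up : Vertex → Vertex
  | even => pos 0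
  | odd => pos 0
  | pos t => pos (t + 1)

@[simp] theorem rank_up (v : Vertex) : v.up.rank = v.rank + 1 := by
  cases v <;> rfl

/-- The vertex `v` occurs at level `n` of the tower. -/
def Valid (n : ℕ) (v : Vertex) : Prop := v.base ≤ n ∧ n % 2 = v.rank % 2

theorem valid_base (v : Vertex) : Valid v.base v := by
  cases v <;> simp [Valid, base, rank]

theorem Valid.add_two {n : ℕ} {v : Vertex} (h : Valid n v) : Valid (n + 2) v := by
  unfold Valid at *; omega

theorem Valid.up {n : ℕ} {v : Vertex} (h : Valid n v) : Valid (n + 1) v.up := by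
  cases v <;> simp only [Valid, base, rank, Vertex.up] at * <;> omega

theorem Valid.of_up {n : ℕ} {v : Vertex} (h : Valid n v.up) : Valid (n + 1) v := by
  cases v <;> simp only [Valid, base, rank, Vertex.up] at * <;> omega

theorem Valid.cases_on {n : ℕ} {v : Vertex} (h : Valid n v) :
    n = v.base ∨ ∃ m, n = m + 2 ∧ Valid m v := by
  by_cases hn : n = v.base
  · exact Or.inl hn
  · refine Or.inr ⟨n - 2, ?_⟩
    cases v <;> simp only [Valid, base, rank] at * <;> omega

/-- After its first occurrence a vertex recurs at every second level, each time with one more cup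
and cap in its monomial. This is the induction for statements about `e n v`. -/
theorem Valid.induction {P : ℕ → Vertex → Prop} (hbase : ∀ v, P v.base v)
    (hstep : ∀ n v, Valid n v → P n v → P (n + 2) v) {n : ℕ} {v : Vertex} (h : Valid n v) :
    P n v := by
  induction n using Nat.strong_induction_on with
  | _ n ih =>
    rcases h.cases_on with rfl | ⟨m, rfl, hm⟩
    · exact hbase v
    · exact hstep m v hm (ih m (by omega) hm)

/-- The only two vertices of equal rank are `even` and `odd`, and both go up to `pos 0`. -/
theorem up_eq_of_rank {v w : Vertex} (h : w.rank + 1 = v.rank) : w.up = v := by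
  cases v <;> cases w <;> simp_all [rank, Vertex.up]

/-- Comparing ranks alone would not be antisymmetric: `even` and `odd` both have rank `0` and must
be incomparable. -/
instance : PartialOrder Vertex where
  le v w := v = w ∨ v.rank < w.rank
  le_refl v := Or.inl rfl
  le_trans u v w := by
    rintro (rfl | h) (rfl | h')
    · exact Or.inl rfl
    · exact Or.inr h'
    · exact Or.inr h
    · exact Or.inr (h.trans h')
  le_antisymm v w := by
    rintro (rfl | h) (h' | h') <;> first | rfl | exact h'.symm | omega

theorem lt_iff_rank_lt {v w : Vertex} : v < w ↔ v.rank < w.rank := by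
  rw [lt_iff_le_not_ge]
  change (v = w ∨ v.rank < w.rank) ∧ ¬ (w = v ∨ w.rank < v.rank) ↔ _
  constructor
  · rintro ⟨rfl | h, h'⟩
    · simp at h'
    · exact h
  · intro h
    refine ⟨Or.inr h, ?_⟩
    rintro (rfl | h') <;> omega

end Vertex

open Vertex

/-- Walks of length `n` from `even` to `v` in the branching graph. -/
inductive Path : ℕ → Vertex → Type
  | nil : Path 0 even
  | up {n : ℕ} {v w : Vertex} (h : w = v.up) (p : Path n v) : Path (n + 1) w
  | down {n : ℕ} {v : Vertex} (p : Path n v.up) : Path (n + 1) v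

namespace Path

theorem valid {n : ℕ} {v : Vertex} (p : Path n v) : Valid n v := by
  induction p with
  | nil => exact valid_base even
  | up h p ih => subst h; exact ih.up
  | down p ih => exact ih.of_up

theorem finite (n : ℕ) : ∀ v, Finite (Path n v) := by
  induction n with
  | zero =>
    intro v
    have : Subsingleton (Path 0 v) := ⟨fun p q => by cases p; cases q; rfl⟩
    infer_instance
  | succ n ih =>
    intro w
    have hfin : Finite {v : Vertex // w = v.up} := by
      apply Set.Finite.to_subtype
      -- If `w = (pos t).up`, then `w` has rank `t + 2`.
      apply Set.Finite.subset (Set.toFinite {even, odd, pos (w.rank - 2)})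
      rintro (_ | _ | t) h
      · simp
      · simp
      · have h' : w = pos (t + 1) := h
        subst h'
        simp [rank]
    let f : ((Σ v : {v : Vertex // w = v.up}, Path n v) ⊕ Path n w.up) → Path (n + 1) w
      | .inl ⟨v, p⟩ => .up v.2 p
      | .inr p => .down p
    refine Finite.of_surjective f fun p => ?_
    cases p with
    | up h p => exact ⟨.inl ⟨⟨_, h⟩, p⟩, rfl⟩
    | down p => exact ⟨.inr p, rfl⟩

noncomputable instance (n : ℕ) (v : Vertex) : Fintype (Path n v) :=
  haveI := finite n v
  Fintype.ofFinite _

end Path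

/-! ### Monomials attached to vertices and walks -/

section Elements

variable {A : Type*} [Ring A]

/-- The monomial with `k` adjacent cups and caps on the right and `rank v` through strands. -/
def elt (b : ℕ → A) (v : Vertex) : ℕ → A
  | 0 => if v = odd then b 0 else 1
  | k + 1 => b (v.base + 2 * k + 1) * elt b v k

/-- The monomial attached to the vertex `v` at level `n`. -/
def e (b : ℕ → A) (n : ℕ) (v : Vertex) : A := elt b v ((n - v.base) / 2)

theorem e_base (b : ℕ → A) (v : Vertex) : e b v.base v = if v = odd then b 0 else 1 := by
  simp [e, elt]

theorem e_add_two (b : ℕ → A) {n : ℕ} {v : Vertex} (h : Valid n v) :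
    e b (n + 2) v = b (n + 1) * e b n v := by
  obtain ⟨k, rfl⟩ : ∃ k, n = v.base + 2 * k := by
    refine ⟨(n - v.base) / 2, ?_⟩
    cases v <;> simp only [Valid, base, rank] at * <;> omega
  have h1 : (v.base + 2 * k + 2 - v.base) / 2 = k + 1 := by omega
  have h2 : (v.base + 2 * k - v.base) / 2 = k := by omega
  simp only [e, h1, h2, elt]

/-- The product of the monomials attached to the vertices of a walk other than the last one. -/
def Path.prod (b : ℕ → A) : ∀ {n : ℕ} {v : Vertex}, Path n v → A
  | _, _, .nil => 1
  | _, _, .up (n := n) (v := v) _ p => p.prod b * e b n v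
  | _, _, .down (n := n) (v := v) p => p.prod b * e b n v.up

/-- The shortest walk climbs the ray, with one final step down if it ends at `odd`. Every vertex
before the last is met at its first level and is not `odd`, so its monomial is `1`. -/
theorem Path.exists_prod_eq_one (b : ℕ → A) (v : Vertex) :
    ∃ p : Path v.base v, p.prod b = 1 := by
  have hpos : ∀ t, ∃ p : Path (t + 1) (pos t), p.prod b = 1 := by
    intro t
    induction t with
    | zero => exact ⟨.up rfl .nil, by simp [Path.prod, show e b 0 even = 1 from e_base b even]⟩
    | succ t ih =>
      obtain ⟨p, hp⟩ := ih
      exact ⟨.up rfl p, by simp [Path.prod, hp, show e b (t + 1) (pos t) = 1 from e_base b (pos t)]⟩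
  cases v with
  | even => exact ⟨.nil, rfl⟩
  | odd =>
    obtain ⟨p, hp⟩ := hpos 0
    exact ⟨.down (v := odd) p, by
      have h : e b 1 odd.up = 1 := e_base b (pos 0)
      simp only [Path.prod, h, mul_one]
      exact hp⟩
  | pos t => exact hpos t

end Elements

/-- The relations of the pair-free Temperley–Lieb algebra of type `D_N`, for a sequence `b` of which
only the first `N` terms matter. -/
structure Relations {R A : Type*} [CommRing R] [Ring A] [Algebra R A] (δ : R) (N : ℕ)
    (b : ℕ → A) : Prop where
  sq : ∀ i < N, b i * b i = δ • b i
  comm : ∀ i j, i + 2 ≤ j → j < N → ¬ (i = 0 ∧ j = 2) → b i * b j = b j * b i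
  zero_one : b 0 * b 1 = 0
  one_zero : b 1 * b 0 = 0
  braid : ∀ i, 1 ≤ i → i + 1 < N → b i * b (i + 1) * b i = b i
  braid' : ∀ i, 1 ≤ i → i + 1 < N → b (i + 1) * b i * b (i + 1) = b (i + 1)
  zero_two : b 0 * b 2 * b 0 = b 0
  two_zero : b 2 * b 0 * b 2 = b 2

/-! ### The tower of subalgebras and the sandwich property -/

section Tower

variable {R A : Type*} [CommRing R] [Ring A] [Algebra R A]

/-- A submodule that contains `1` and is stable under left multiplication by generators contains the
subalgebra they generate. -/
theorem adjoin_le_of_mul_mem {s : Set A} {Q : Submodule R A} (h1 : 1 ∈ Q)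
    (h : ∀ g ∈ s, ∀ q ∈ Q, g * q ∈ Q) {x : A} (hx : x ∈ Algebra.adjoin R s) : x ∈ Q := by
  have : ∀ q ∈ Q, x * q ∈ Q := by
    induction hx using Algebra.adjoin_induction with
    | mem g hg => exact h g hg
    | algebraMap r => intro q hq; rw [← Algebra.smul_def]; exact Q.smul_mem r hq
    | add x y _ _ hx hy => intro q hq; rw [add_mul]; exact Q.add_mem (hx q hq) (hy q hq)
    | mul x y _ _ hx hy => intro q hq; rw [mul_assoc]; exact hx _ (hy q hq)
  simpa using this 1 h1

variable (R) in
/-- The subalgebra generated by the generators that live on the first `n` strands. -/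
def level (b : ℕ → A) (n : ℕ) : Subalgebra R A :=
  -- Both `b 0` and `b 1` involve the first two strands, so they enter together at level 2; hence
  -- `max i 1`.
  Algebra.adjoin R {x | ∃ i, max i 1 < n ∧ x = b i}

theorem mem_level (b : ℕ → A) {n i : ℕ} (h : max i 1 < n) : b i ∈ level R b n :=
  Algebra.subset_adjoin ⟨i, h, rfl⟩

theorem level_mono (b : ℕ → A) {m n : ℕ} (h : m ≤ n) : level R b m ≤ level R b n := by
  apply Algebra.adjoin_mono
  rintro x ⟨i, hi, rfl⟩
  exact ⟨i, by omega, rfl⟩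

theorem mem_level_of_le_one (b : ℕ → A) {n : ℕ} (hn : n ≤ 1) {x : A} (hx : x ∈ level R b n) :
    ∃ r : R, x = algebraMap R A r := by
  have : {x | ∃ i, max i 1 < n ∧ x = b i} = (∅ : Set A) := by
    ext y
    simp only [Set.mem_ofPred_eq, Set.mem_empty_iff_false, iff_false]
    rintro ⟨i, hi, -⟩
    omega
  rw [level, this, Algebra.adjoin_empty] at hx
  obtain ⟨r, hr⟩ := Algebra.mem_bot.1 hx
  exact ⟨r, hr.symm⟩

theorem e_mem_level (b : ℕ → A) {n : ℕ} {v : Vertex} (h : Valid n v) : e b n v ∈ level R b n := by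
  refine Valid.induction (P := fun n v => e b n v ∈ level R b n) ?_ ?_ h
  · intro v
    rw [e_base]
    split_ifs with hv
    · subst hv; exact mem_level b (by simp [base])
    · exact one_mem _
  · intro n v hv ih
    rw [e_add_two b hv]
    exact mul_mem (mem_level b (by omega)) (level_mono b (by omega) ih)

theorem Path.prod_mem_level (b : ℕ → A) {n : ℕ} {v : Vertex} (p : Path n v) :
    p.prod b ∈ level R b n := by
  induction p with
  | nil => exact one_mem _
  | up h p ih =>
    exact level_mono b (Nat.le_succ _) (mul_mem ih (e_mem_level b p.valid))
  | down p ih =>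
    exact level_mono b (Nat.le_succ _) (mul_mem ih (e_mem_level b p.valid))

namespace Relations

variable {δ : R} {N : ℕ} {b : ℕ → A}

theorem commute_of_mem_level (hb : Relations δ N b) {n m : ℕ} (hm : n < m) (hmN : m < N) {x : A}
    (hx : x ∈ level R b n) : x * b m = b m * x := by
  induction hx using Algebra.adjoin_induction with
  | mem g hg =>
    obtain ⟨i, hi, rfl⟩ := hg
    -- For `i = 0` the level is at least 2, so `m ≥ 3` and the joined pair `(0, 2)` does not occur.
    exact hb.comm i m (by omega) hmN (by omega)
  | algebraMap r => exact Algebra.commutes r _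
  | add x y _ _ hx hy => rw [add_mul, mul_add, hx, hy]
  | mul x y _ _ hx hy => rw [mul_assoc, hy, ← mul_assoc, hx, mul_assoc]

/-- The pair-free relations make the span of `1`, `b 0`, `b 1` stable under multiplication, with no
further product `b 0 * b 1` to account for. -/
theorem mem_span_of_mem_level_two (hb : Relations δ N b) (hN : 2 ≤ N) {x : A}
    (hx : x ∈ level R b 2) : ∃ r s t : R, x = r • 1 + s • b 0 + t • b 1 := by
  have : x ∈ Submodule.span R {1, b 0, b 1} := by
    refine adjoin_le_of_mul_mem (Submodule.subset_span (by simp)) ?_ hx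
    rintro g ⟨i, hi, rfl⟩ q hq
    rw [Submodule.mem_span_triple] at hq ⊢
    obtain ⟨r, s, t, rfl⟩ := hq
    have hi : i = 0 ∨ i = 1 := by omega
    rcases hi with rfl | rfl
    · refine ⟨0, r + s * δ, 0, ?_⟩
      simp only [mul_add, mul_smul_comm, mul_one, hb.sq 0 (by omega), hb.zero_one]
      module
    · refine ⟨0, 0, r + t * δ, ?_⟩
      simp only [mul_add, mul_smul_comm, mul_one, hb.sq 1 (by omega), hb.one_zero]
      module
  rw [Submodule.mem_span_triple] at this
  obtain ⟨r, s, t, h⟩ := this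
  exact ⟨r, s, t, h.symm⟩

/-- The span of `level n` and `level n * b n * level n`. -/
def twoTerm (R : Type*) {A : Type*} [CommRing R] [Ring A] [Algebra R A] (b : ℕ → A) (n : ℕ) :
    Submodule R A :=
  Subalgebra.toSubmodule (level R b n) ⊔
    Submodule.span R {x | ∃ y ∈ level R b n, ∃ z ∈ level R b n, x = y * b n * z}

/-- Between two occurrences of `b n` stands an element of `level n`, and sandwiching removes one of
them; so one occurrence always suffices. From `n = 2` on, `b n` is the only new generator of `level
(n + 1)`. -/
theorem mem_twoTerm_of_sandwich {n : ℕ} (hn : 2 ≤ n)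
    (hs : ∀ x ∈ level R b n, ∃ y ∈ level R b n, b n * x * b n = y * b n) {x : A}
    (hx : x ∈ level R b (n + 1)) : x ∈ twoTerm R b n := by
  refine adjoin_le_of_mul_mem (Submodule.mem_sup_left (one_mem (level R b n))) ?_ hx
  rintro g ⟨i, hi, rfl⟩ q hq
  obtain ⟨y, hy, z, hz, rfl⟩ := Submodule.mem_sup.1 hq
  have hy : y ∈ level R b n := hy
  rw [mul_add]
  rcases (by omega : i = n ∨ max i 1 < n) with rfl | hi
  · refine Submodule.add_mem _ (Submodule.mem_sup_right (Submodule.subset_span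
      ⟨1, one_mem _, y, hy, by rw [one_mul]⟩)) (Submodule.mem_sup_right ?_)
    clear hq
    induction hz using Submodule.span_induction with
    | mem z hz =>
      obtain ⟨y, hy, z, hz, rfl⟩ := hz
      obtain ⟨w, hw, h⟩ := hs y hy
      exact Submodule.subset_span ⟨w, hw, z, hz, by rw [← h]; simp only [mul_assoc]⟩
    | zero => simp
    | add x y _ _ hx hy => rw [mul_add]; exact Submodule.add_mem _ hx hy
    | smul r x _ hx => rw [mul_smul_comm]; exact Submodule.smul_mem _ _ hx
  · refine Submodule.add_mem _ (Submodule.mem_sup_left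
      (show b i * y ∈ level R b n from mul_mem (mem_level b hi) hy))
      (Submodule.mem_sup_right ?_)
    clear hq
    induction hz using Submodule.span_induction with
    | mem z hz =>
      obtain ⟨y, hy, z, hz, rfl⟩ := hz
      exact Submodule.subset_span ⟨b i * y, mul_mem (mem_level b hi) hy, z, hz,
        by simp only [mul_assoc]⟩
    | zero => simp
    | add x y _ _ hx hy => rw [mul_add]; exact Submodule.add_mem _ hx hy
    | smul r x _ hx => rw [mul_smul_comm]; exact Submodule.smul_mem _ _ hx

/-- `level n * b n` absorbs elements of `twoTerm n` multiplied by `b n` if `b n` sandwiches. -/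
theorem exists_mul_eq_of_mem_twoTerm {n : ℕ} {B : Subalgebra R A} {c : A}
    {l : A} (hy : ∀ y ∈ level R b n, ∃ w ∈ B, l * y * c = w * c)
    (hyz : ∀ y ∈ level R b n, ∀ z ∈ level R b n, ∃ w ∈ B, l * (y * b n * z) * c = w * c) {x : A}
    (hx : x ∈ twoTerm R b n) : ∃ w ∈ B, l * x * c = w * c := by
  obtain ⟨y, hy', z, hz, rfl⟩ := Submodule.mem_sup.1 hx
  obtain ⟨w, hw, h⟩ := hy y hy'
  suffices ∃ w ∈ B, l * z * c = w * c by
    obtain ⟨w', hw', h'⟩ := this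
    exact ⟨w + w', add_mem hw hw', by rw [mul_add, add_mul, add_mul, h, h']⟩
  clear hx
  induction hz using Submodule.span_induction with
  | mem z hz =>
    obtain ⟨y, hy, z, hz, rfl⟩ := hz
    exact hyz y hy z hz
  | zero => exact ⟨0, zero_mem _, by simp⟩
  | add x y _ _ hx hy =>
    obtain ⟨w, hw, h⟩ := hx
    obtain ⟨w', hw', h'⟩ := hy
    exact ⟨w + w', add_mem hw hw', by rw [mul_add, add_mul, add_mul, h, h']⟩
  | smul r x _ hx =>
    obtain ⟨w, hw, h⟩ := hx
    exact ⟨r • w, B.smul_mem hw r, by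
      rw [mul_smul_comm, smul_mul_assoc, smul_mul_assoc, h]⟩

/-- The conditional expectation of the tower. Beyond the first two levels, `x` has at most one `b n`
by the inductive hypothesis; the rest of `x` commutes with `b (n + 1)`, and `b (n + 1) * b n * b (n
+ 1) = b (n + 1)`. Level 2 is treated by hand, since both `b 0` and `b 1` are joined to `b 2`. -/
theorem sandwich (hb : Relations δ N b) (n : ℕ) (hn : n + 1 < N) :
    ∀ x ∈ level R b (n + 1), ∃ y ∈ level R b n, b (n + 1) * x * b (n + 1) = y * b (n + 1) := by
  induction n with
  | zero =>
    intro x hx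
    obtain ⟨r, rfl⟩ := mem_level_of_le_one b le_rfl hx
    refine ⟨algebraMap R A (r * δ), Subalgebra.algebraMap_mem _ _, ?_⟩
    rw [← Algebra.commutes, mul_assoc, hb.sq 1 hn, map_mul, mul_assoc, Algebra.smul_def]
  | succ n ih =>
    rcases n with _ | n
    · intro x hx
      obtain ⟨r, s, t, rfl⟩ := hb.mem_span_of_mem_level_two (by omega) hx
      refine ⟨algebraMap R A (r * δ + s + t), Subalgebra.algebraMap_mem _ _, ?_⟩
      have h0 : b 2 * b 0 * b 2 = b 2 := hb.two_zero
      have h1 : b 2 * b 1 * b 2 = b 2 := hb.braid' 1 le_rfl hn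
      have h2 : b 2 * b 2 = δ • b 2 := hb.sq 2 hn
      rw [← Algebra.smul_def]
      simp only [Nat.reduceAdd, mul_add, add_mul, mul_smul_comm, smul_mul_assoc, mul_one, h0, h1, h2]
      module
    · intro x hx
      have hx' : x ∈ twoTerm R b (n + 2) := by
        refine mem_twoTerm_of_sandwich (by omega) (fun x hx => ?_) hx
        obtain ⟨y, hy, h⟩ := ih (by omega) x hx
        exact ⟨y, level_mono b (by omega) hy, h⟩
      refine exists_mul_eq_of_mem_twoTerm ?_ ?_ hx'
      · intro y hy
        refine ⟨δ • y, Subalgebra.smul_mem _ hy _, ?_⟩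
        rw [← hb.commute_of_mem_level (by omega) hn hy, mul_assoc, hb.sq _ hn, smul_mul_assoc,
          mul_smul_comm]
      · intro y hy z hz
        refine ⟨y * z, mul_mem hy hz, ?_⟩
        have h := hb.braid' (n + 2) (by omega) hn
        have hy := hb.commute_of_mem_level (Nat.lt_succ_self _) hn hy
        have hz := hb.commute_of_mem_level (Nat.lt_succ_self _) hn hz
        calc b (n + 2 + 1) * (y * b (n + 2) * z) * b (n + 2 + 1)
            = (b (n + 2 + 1) * y) * b (n + 2) * (z * b (n + 2 + 1)) := by simp only [mul_assoc]
          _ = y * (b (n + 2 + 1) * b (n + 2) * b (n + 2 + 1)) * z := by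
              rw [← hy, hz]; simp only [mul_assoc]
          _ = y * z * b (n + 2 + 1) := by rw [h, mul_assoc, mul_assoc, hz]

theorem level_two_mul_zero (hb : Relations δ N b) (hN : 2 ≤ N) {x : A}
    (hx : x ∈ level R b 2) : ∃ r : R, x * b 0 = r • b 0 := by
  obtain ⟨r, s, t, rfl⟩ := hb.mem_span_of_mem_level_two hN hx
  refine ⟨r + s * δ, ?_⟩
  simp only [add_mul, smul_mul_assoc, one_mul, hb.sq 0 (by omega), hb.one_zero]
  module

/-- Above the lowest case, an element of `level (n + 2)` needs at most one `b (n + 1)`; if it has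
one, the sandwich property merges it with the factor on the right. -/
theorem level_succ_mul (hb : Relations δ N b) {n : ℕ} (hn : n + 1 < N) {x : A}
    (hx : x ∈ level R b (n + 2)) : ∃ y ∈ level R b (n + 1), x * b (n + 1) = y * b (n + 1) := by
  rcases n with _ | n
  · obtain ⟨r, s, t, rfl⟩ := hb.mem_span_of_mem_level_two (by omega) hx
    refine ⟨algebraMap R A (r + t * δ), Subalgebra.algebraMap_mem _ _, ?_⟩
    rw [← Algebra.smul_def]
    simp only [zero_add, add_mul, smul_mul_assoc, one_mul, hb.sq 1 hn, hb.zero_one]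
    module
  · have hs := hb.sandwich (n + 1) hn
    have hx' : x ∈ twoTerm R b (n + 2) := by
      refine mem_twoTerm_of_sandwich (by omega) (fun x hx => ?_) hx
      obtain ⟨y, hy, h⟩ := hs x hx
      exact ⟨y, level_mono b (by omega) hy, h⟩
    have := exists_mul_eq_of_mem_twoTerm (l := 1) (c := b (n + 2)) (B := level R b (n + 2))
      (fun y hy => ⟨y, hy, by rw [one_mul]⟩) (fun y hy z hz => ?_) hx'
    · simpa only [one_mul] using this
    · obtain ⟨w, hw, h⟩ := hs z hz
      refine ⟨y * w, mul_mem hy (level_mono b (by omega) hw), ?_⟩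
      rw [one_mul, mul_assoc y w, ← h]
      simp only [mul_assoc]

theorem sandwich_full (hb : Relations δ N b) {n : ℕ} (hn : n + 1 < N) {x : A}
    (hx : x ∈ level R b (n + 2)) :
    ∃ y ∈ level R b n, b (n + 1) * x * b (n + 1) = y * b (n + 1) := by
  obtain ⟨y, hy, h⟩ := hb.level_succ_mul hn hx
  obtain ⟨z, hz, h'⟩ := hb.sandwich n hn y hy
  exact ⟨z, hz, by rw [mul_assoc, h, ← mul_assoc, h']⟩

end Relations

/-! ### The filtration by through strands and the span of walks -/

variable (R) in
/-- The span of the two-sided ideals of `level n` generated by the `e n w` with fewer than `r`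
through strands. -/
def lower (b : ℕ → A) (n r : ℕ) : Submodule R A :=
  Submodule.span R {x | ∃ w, Valid n w ∧ w.rank < r ∧
    ∃ y ∈ level R b n, ∃ z ∈ level R b n, x = y * e b n w * z}

theorem mem_lower (b : ℕ → A) {n r : ℕ} {w : Vertex} (hw : Valid n w) (hr : w.rank < r) {y z : A}
    (hy : y ∈ level R b n) (hz : z ∈ level R b n) : y * e b n w * z ∈ lower R b n r :=
  Submodule.subset_span ⟨w, hw, hr, y, hy, z, hz, rfl⟩

/-- To bound `l * lower * c` it suffices to look at the generators of `lower`. -/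
theorem mul_lower_mul (b : ℕ → A) {n r : ℕ} {Q : Submodule R A} {l c : A}
    (h : ∀ w, Valid n w → w.rank < r → ∀ y ∈ level R b n, ∀ z ∈ level R b n,
      l * (y * e b n w * z) * c ∈ Q) {x : A} (hx : x ∈ lower R b n r) : l * x * c ∈ Q := by
  induction hx using Submodule.span_induction with
  | mem x hx => obtain ⟨w, hw, hr, y, hy, z, hz, rfl⟩ := hx; exact h w hw hr y hy z hz
  | zero => simp
  | add x y _ _ hx hy => rw [mul_add, add_mul]; exact Q.add_mem hx hy
  | smul r x _ hx => rw [mul_smul_comm, smul_mul_assoc]; exact Q.smul_mem _ hx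

theorem mul_lower_mul_mem (b : ℕ → A) {n r : ℕ} {x y z : A} (hx : x ∈ lower R b n r)
    (hy : y ∈ level R b n) (hz : z ∈ level R b n) : y * x * z ∈ lower R b n r := by
  refine mul_lower_mul b (fun w hw hr y' hy' z' hz' => ?_) hx
  have := mem_lower b hw hr (mul_mem hy hy') (mul_mem hz' hz)
  simpa only [mul_assoc] using this

theorem mul_mem_lower (b : ℕ → A) {n r : ℕ} {x y : A} (hx : x ∈ lower R b n r)
    (hy : y ∈ level R b n) : y * x ∈ lower R b n r := by
  simpa using mul_lower_mul_mem b hx hy (one_mem _)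

theorem lower_mul_mem (b : ℕ → A) {n r : ℕ} {x z : A} (hx : x ∈ lower R b n r)
    (hz : z ∈ level R b n) : x * z ∈ lower R b n r := by
  simpa using mul_lower_mul_mem b hx (one_mem _) hz

namespace Relations

variable {δ : R} {N : ℕ} {b : ℕ → A}

/-- Zigzags straighten one cup at a time, by `b_{n+1} b_{n+2} b_{n+1} = b_{n+1}`. The induction
starts from `1` for `even` and `pos t`, and from `b_0 b_2 b_0 = b_0` for `odd`. The identity allows
the monomial of a neighbour to be inserted, which is how walks get extended. -/
theorem e_mul_e_up_mul_e (hb : Relations δ N b) {n : ℕ} {v : Vertex} (h : Valid n v) :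
    n < N → e b n v * e b (n + 1) v.up * e b n v = e b n v := by
  refine Valid.induction (P := fun n v => n < N → e b n v * e b (n + 1) v.up * e b n v = e b n v)
    ?_ ?_ h
  · rintro (_ | _ | t) hn
    · have h1 := e_base b even
      have h2 := e_base b (pos 0)
      simp only [base, reduceCtorEq, if_false] at h1 h2
      simp [base, Vertex.up, h1, h2]
    · have h1 := e_base b odd
      have h2 := e_add_two b (valid_base (pos 0))
      rw [e_base b (pos 0)] at h2
      simp only [base, reduceCtorEq, if_false, if_true, mul_one] at h1 h2
      simp only [base, Vertex.up, h1]
      rw [h2]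
      exact hb.zero_two
    · have h1 := e_base b (pos t)
      have h2 := e_base b (pos (t + 1))
      simp only [base, reduceCtorEq, if_false] at h1 h2
      simp [base, Vertex.up, h1, h2]
  · intro n v hv ih hn
    have h1 := hb.commute_of_mem_level (Nat.lt_succ_self n) (by omega) (e_mem_level (R := R) b hv)
    have h2 := hb.commute_of_mem_level (m := n + 2) (by omega) (by omega)
      (e_mem_level (R := R) b hv)
    have h3 := hb.braid (n + 1) (by omega) (by omega)
    rw [show n + 2 + 1 = (n + 1) + 2 by ring, e_add_two b hv, e_add_two b hv.up]
    calc b (n + 1) * e b n v * (b (n + 1 + 1) * e b (n + 1) v.up) * (b (n + 1) * e b n v)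
        = b (n + 1) * (e b n v * b (n + 2)) * e b (n + 1) v.up * (b (n + 1) * e b n v) := by
          simp only [mul_assoc]
      _ = b (n + 1) * b (n + 2) * (e b n v * e b (n + 1) v.up * e b n v) * b (n + 1) := by
          rw [h2, ← h1]; simp only [mul_assoc]
      _ = b (n + 1) * b (n + 1 + 1) * b (n + 1) * e b n v := by
          rw [ih (by omega), mul_assoc, h1, ← mul_assoc]
      _ = b (n + 1) * e b n v := by rw [h3]

/-- The ideal generated by `e n w` is contained in the ideal one level up. -/
theorem lower_le_lower_succ (hb : Relations δ N b) {n r : ℕ} (hn : n < N) :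
    lower R b n r ≤ lower R b (n + 1) (r + 1) := by
  refine Submodule.span_le.2 ?_
  rintro x ⟨w, hw, hr, y, hy, z, hz, rfl⟩
  have he := e_mem_level (R := R) b hw
  have := mem_lower (R := R) b hw.up (r := r + 1) (by rw [rank_up]; omega)
    (level_mono b (Nat.le_succ n) (mul_mem hy he)) (level_mono b (Nat.le_succ n) (mul_mem he hz))
  rw [SetLike.mem_coe]
  convert this using 1
  conv_lhs => rw [← hb.e_mul_e_up_mul_e hw hn]
  simp only [mul_assoc]

/-- The last generator is the monomial of `pos n` at level `n + 3`. The relation `b_i b_j b_i = b_i`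
carries membership in the ideal along the edges of the Coxeter graph, which is connected from three
generators on. -/
theorem generator_mem_lower (hb : Relations δ N b) {n : ℕ} (hn : n + 3 ≤ N) {i : ℕ}
    (hi : i < n + 3) : b i ∈ lower R b (n + 3) (n + 3) := by
  have htop : b (n + 2) ∈ lower R b (n + 3) (n + 3) := by
    have h := mem_lower (R := R) b (valid_base (pos n)).add_two (r := n + 3)
      (by simp [rank]) (one_mem _) (one_mem _)
    rw [e_add_two b (valid_base (pos n)), e_base] at h
    simpa [base] using h
  have key : ∀ k, k ≤ n + 1 → b (n + 2 - k) ∈ lower R b (n + 3) (n + 3) := by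
    intro k
    induction k with
    | zero => intro _; exact htop
    | succ k ih =>
      intro hk
      have hm : b (n + 2 - (k + 1)) ∈ level R b (n + 3) := mem_level b (by omega)
      have := mul_lower_mul_mem b (ih (by omega)) hm hm
      have h := hb.braid (n + 2 - (k + 1)) (by omega) (by omega)
      rw [show n + 2 - (k + 1) + 1 = n + 2 - k by omega] at h
      rwa [h] at this
  rcases i with _ | i
  · have hm : b 0 ∈ level R b (n + 3) := mem_level b (by omega)
    have h2 := key n (by omega)
    rw [show n + 2 - n = 2 by omega] at h2
    have := mul_lower_mul_mem b h2 hm hm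
    rwa [hb.zero_two] at this
  · have := key (n + 2 - (i + 1)) (by omega)
    rwa [show n + 2 - (n + 2 - (i + 1)) = i + 1 by omega] at this

theorem level_base_mul_e (hb : Relations δ N b) (v : Vertex) (hv : v.base ≤ N) {x : A}
    (hx : x ∈ level R b v.base) :
    ∃ r : R, x * e b v.base v - r • e b v.base v ∈ lower R b v.base v.rank := by
  rcases v with _ | _ | t
  · obtain ⟨r, rfl⟩ := mem_level_of_le_one b (by simp [base]) hx
    exact ⟨r, by rw [Algebra.smul_def, sub_self]; exact zero_mem _⟩
  · obtain ⟨r, h⟩ := hb.level_two_mul_zero hv hx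
    exact ⟨r, by simp [e_base, h]⟩
  · simp only [base] at hv hx ⊢
    have he := e_base b (pos t)
    simp only [base, reduceCtorEq, if_false] at he
    simp only [he, mul_one, rank]
    rcases t with _ | _ | t
    · obtain ⟨r, rfl⟩ := mem_level_of_le_one b le_rfl hx
      exact ⟨r, by rw [Algebra.smul_def, mul_one, sub_self]; exact zero_mem _⟩
    · obtain ⟨r, s, t, rfl⟩ := hb.mem_span_of_mem_level_two hv hx
      refine ⟨r, ?_⟩
      rw [show r • (1 : A) + s • b 0 + t • b 1 - r • 1 = s • b 0 + t • b 1 by abel]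
      -- At level 2 the generators `b 0` and `b 1` are not joined; they are the monomials of the two
      -- different vertices `odd` and `even`.
      have h0 := mem_lower (R := R) b (valid_base odd) (r := 2) (by simp [rank]) (one_mem _)
        (one_mem _)
      have h1 := mem_lower (R := R) b (valid_base even).add_two (r := 2) (by simp [rank])
        (one_mem _) (one_mem _)
      rw [e_base] at h0
      rw [e_add_two b (valid_base even), e_base] at h1
      simp only [base, reduceCtorEq, if_false, if_true, one_mul, mul_one, zero_add] at h0 h1
      exact Submodule.add_mem _ (Submodule.smul_mem _ _ h0) (Submodule.smul_mem _ _ h1)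
    · have : x ∈ Submodule.span R {1} ⊔ lower R b (t + 3) (t + 3) := by
        refine adjoin_le_of_mul_mem (Submodule.mem_sup_left (Submodule.mem_span_singleton_self 1))
          ?_ hx
        rintro g ⟨i, hi, rfl⟩ q hq
        obtain ⟨y, hy, z, hz, rfl⟩ := Submodule.mem_sup.1 hq
        obtain ⟨r, rfl⟩ := Submodule.mem_span_singleton.1 hy
        refine Submodule.mem_sup_right ?_
        rw [mul_add, mul_smul_comm, mul_one]
        exact Submodule.add_mem _
          (Submodule.smul_mem _ _ (hb.generator_mem_lower hv (by omega)))
          (mul_mem_lower b hz (mem_level b hi))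
      obtain ⟨y, hy, z, hz, rfl⟩ := Submodule.mem_sup.1 this
      obtain ⟨r, rfl⟩ := Submodule.mem_span_singleton.1 hy
      exact ⟨r, by rwa [add_sub_cancel_left]⟩

/-- The monomials `e n v` sandwich the algebra to scalars, up to fewer through strands. -/
theorem e_sandwich (hb : Relations δ N b) {n : ℕ} {v : Vertex} (h : Valid n v) :
    n ≤ N → ∀ x ∈ level R b n,
      ∃ r : R, e b n v * x * e b n v - r • e b n v ∈ lower R b n v.rank := by
  refine Valid.induction (P := fun n v => n ≤ N → ∀ x ∈ level R b n,
      ∃ r : R, e b n v * x * e b n v - r • e b n v ∈ lower R b n v.rank) ?_ ?_ h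
  · intro v hv x hx
    exact hb.level_base_mul_e v hv (mul_mem (e_mem_level b (valid_base v)) hx)
  · intro n v hv ih hn x hx
    obtain ⟨y, hy, hxy⟩ := hb.sandwich_full (by omega) hx
    obtain ⟨r, hr⟩ := ih (by omega) y hy
    refine ⟨r, ?_⟩
    have hc : ∀ z ∈ level R b n, z * b (n + 1) = b (n + 1) * z := fun z hz =>
      hb.commute_of_mem_level (Nat.lt_succ_self n) (by omega) hz
    have hev := e_mem_level (R := R) b hv
    have heq : e b (n + 2) v * x * e b (n + 2) v - r • e b (n + 2) v =
        1 * (e b n v * y * e b n v - r • e b n v) * b (n + 1) := by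
      rw [e_add_two b hv, one_mul, sub_mul, smul_mul_assoc, hc _ hev]
      congr 1
      calc b (n + 1) * e b n v * x * (b (n + 1) * e b n v)
          = e b n v * (b (n + 1) * x * b (n + 1)) * e b n v := by
            rw [← hc _ hev, mul_assoc (e b n v)]; simp only [mul_assoc]; rw [hc _ hev]
        _ = _ := by rw [hxy]; simp only [mul_assoc]; rw [hc _ hev]
    rw [heq]
    refine mul_lower_mul b (fun w hw hr y hy z hz => ?_) hr
    have := mem_lower b hw.add_two hr (level_mono b (Nat.le_add_right n 2) hy)
      (level_mono b (Nat.le_add_right n 2) hz)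
    convert this using 1
    rw [e_add_two b hw, one_mul, mul_assoc (y * _), hc z hz,
      ← hc _ (e_mem_level (R := R) b hw)]
    simp only [mul_assoc]

variable (R) in
/-- The span of the elements of the left ideal of `e n v` attached to walks. -/
def cellSpan (b : ℕ → A) (n : ℕ) (v : Vertex) : Submodule R A :=
  Submodule.span R (Set.range fun p : Path n v => p.prod b * e b n v)

/-- Away from the first level of `v`, `x * e (n + 2) v` is rewritten as an element of the left ideal
of `e (n + 1) v.up` times `e (n + 2) v`. The inductive hypothesis for `v.up` gives walks ending with
a step down, and an error with fewer through strands. In that error, the part from a lower neighbour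
of `v` gives walks ending with a step up; the remainder lies in `lower`. -/
theorem mul_e_mem (hb : Relations δ N b) (n : ℕ) : n ≤ N → ∀ v, Valid n v → ∀ x ∈ level R b n,
    x * e b n v ∈ cellSpan R b n v ⊔ lower R b n v.rank := by
  induction n using Nat.strong_induction_on with
  | _ n ih =>
    intro hn v hv x hx
    rcases hv.cases_on with rfl | ⟨n, rfl, hv'⟩
    · obtain ⟨r, hr⟩ := hb.level_base_mul_e v hn hx
      obtain ⟨p, hp⟩ := Path.exists_prod_eq_one b v
      rw [← add_sub_cancel (r • e b v.base v) (x * e b v.base v)]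
      refine Submodule.add_mem_sup (Submodule.smul_mem _ _ (Submodule.subset_span ⟨p, ?_⟩)) hr
      simp only [hp, one_mul]
    · set Q := cellSpan R b (n + 2) v ⊔ lower R b (n + 2) v.rank with hQ
      have hlow : ∀ {y}, y ∈ lower R b (n + 2) v.rank → y ∈ Q := fun h =>
        Submodule.mem_sup_right h
      have he2 := e_mem_level (R := R) b hv
      have hmono : ∀ {y}, y ∈ level R b (n + 1) → y ∈ level R b (n + 2) := fun h =>
        level_mono b (Nat.le_succ _) h
      have hev := e_mem_level (R := R) b hv'
      -- ideals of `level (n + 1)` below the neighbours of `v`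
      have hdeep : ∀ {s y}, s + 1 ≤ v.rank → y ∈ lower R b (n + 1) s →
          y * e b (n + 2) v ∈ lower R b (n + 2) v.rank := by
        intro s y hs hy
        have h1 := hb.lower_le_lower_succ (by omega) hy
        have h2 : lower R b (n + 2) (s + 1) ≤ lower R b (n + 2) v.rank := by
          refine Submodule.span_mono ?_
          rintro x ⟨w, hw, hr, h⟩
          exact ⟨w, hw, by omega, h⟩
        exact lower_mul_mem b (h2 h1) he2
      -- Here `v = w.up`. Write `e_w = e_w e_v e_w`; then `e_v * (e_w * z) * e_v` is a scalar times
      -- `e_v` modulo `lower`, and what remains is the walk extended by a step up.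
      have hcell : ∀ w, Valid (n + 1) w → w.rank + 1 = v.rank → ∀ c ∈ cellSpan R b (n + 1) w,
          ∀ z ∈ level R b (n + 1), c * z * e b (n + 2) v ∈ Q := by
        intro w hw heq c hc z hz
        obtain rfl : w.up = v := up_eq_of_rank heq
        induction hc using Submodule.span_induction with
        | zero => simp
        | add x y _ _ hx hy => rw [add_mul, add_mul]; exact Submodule.add_mem _ hx hy
        | smul r x _ hx =>
          rw [smul_mul_assoc, smul_mul_assoc]; exact Submodule.smul_mem _ _ hx
        | mem c hc =>
          obtain ⟨p, rfl⟩ := hc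
          have hew := e_mem_level (R := R) b hw
          obtain ⟨r, hr⟩ := hb.e_sandwich hv hn _ (hmono (mul_mem hew hz))
          have heq : p.prod b * e b (n + 1) w * z * e b (n + 2) w.up =
              r • (p.prod b * e b (n + 1) w * e b (n + 2) w.up) +
              p.prod b * e b (n + 1) w * (e b (n + 2) w.up * (e b (n + 1) w * z) *
                e b (n + 2) w.up - r • e b (n + 2) w.up) := by
            rw [mul_sub, mul_smul_comm, add_sub_cancel]
            conv_lhs => rw [← hb.e_mul_e_up_mul_e hw (by omega)]
            simp only [mul_assoc]
          change p.prod b * e b (n + 1) w * z * e b (n + 2) w.up ∈ Q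
          rw [heq]
          exact Submodule.add_mem_sup
            (Submodule.smul_mem _ _ (Submodule.subset_span ⟨.up rfl p, rfl⟩))
            (mul_mem_lower b hr (hmono (mul_mem (p.prod_mem_level b) hew)))
      have hlowup : ∀ {y}, y ∈ lower R b (n + 1) v.up.rank → y * e b (n + 2) v ∈ Q := by
        intro y hy
        rw [← one_mul y]
        refine mul_lower_mul b (fun w hw hr y hy z hz => ?_) hy
        rw [one_mul]
        -- The ranks of `w` and `v` have the parities of `n + 1` and `n + 2`, so `w.rank ≤ v.rank`
        -- cannot be an equality.
        have hpar : w.rank + 1 ≤ v.rank := by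
          have h1 := hw.2
          have h2 := hv.2
          rw [rank_up] at hr
          omega
        have h3 := ih (n + 1) (by omega) (by omega) w hw y hy
        obtain ⟨c, hc, l, hl, hcl⟩ := Submodule.mem_sup.1 h3
        rw [← hcl, add_mul, add_mul]
        refine Submodule.add_mem _ ?_ (hlow (hdeep hpar (lower_mul_mem b hl hz)))
        rcases hpar.lt_or_eq with hlt | heq
        · have hcl' : c ∈ lower R b (n + 1) (w.rank + 1) := by
            refine Submodule.span_le.2 ?_ hc
            rintro x ⟨p, rfl⟩
            have := mem_lower (R := R) b hw (r := w.rank + 1) (by omega) (p.prod_mem_level b)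
              (one_mem _)
            simpa using this
          exact hlow (hdeep (by omega) (lower_mul_mem b hcl' hz))
        · exact hcell w hw heq c hc z hz
      obtain ⟨y, hy, hxy⟩ := hb.level_succ_mul (by omega) hx
      have hc := hb.commute_of_mem_level (Nat.lt_succ_self n) (by omega) hev
      -- Move `x` into `level (n + 1)` across `b (n + 1)`, then insert `e (n + 1) v.up` between two
      -- copies of `e n v`.
      have hxe : x * e b (n + 2) v = y * e b n v * e b (n + 1) v.up * e b (n + 2) v := by
        rw [e_add_two b hv', ← mul_assoc, hxy, mul_assoc, ← hc]
        conv_lhs => rw [← hb.e_mul_e_up_mul_e hv' (by omega)]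
        simp only [mul_assoc]
      rw [hxe]
      have h3 := ih (n + 1) (by omega) (by omega) v.up hv'.up (y * e b n v)
        (mul_mem hy (level_mono b (Nat.le_succ n) hev))
      obtain ⟨c, hc, l, hl, hcl⟩ := Submodule.mem_sup.1 h3
      rw [← hcl, add_mul]
      refine Submodule.add_mem _ ?_ (hlowup hl)
      clear hcl h3
      induction hc using Submodule.span_induction with
      | zero => simp
      | add x y _ _ hx hy => rw [add_mul]; exact Submodule.add_mem _ hx hy
      | smul r x _ hx => rw [smul_mul_assoc]; exact Submodule.smul_mem _ _ hx
      | mem c hc =>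
        obtain ⟨p, rfl⟩ := hc
        exact Submodule.mem_sup_left (Submodule.subset_span ⟨.down p, rfl⟩)

end Relations

end Tower

end PairFree

/-! ### The anti-involution and the cell datum -/

namespace PairFree

open Vertex

section Cell

variable {R A : Type*} [CommRing R] [Ring A] [Algebra R A]

/-- The element of the cellular basis attached to a pair of walks with the same end. -/
def cell (b : ℕ → A) (N : ℕ) (star : A →ₗ[R] A) (i : Σ v, Path N v × Path N v) : A :=
  i.2.1.prod b * e b N i.1 * star (i.2.2.prod b)

/-- The span of the basis elements with fewer than `r` through strands. -/
def cellLower (b : ℕ → A) (N : ℕ) (star : A →ₗ[R] A) (r : ℕ) : Submodule R A :=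
  Submodule.span R {x | ∃ v : Vertex, v.rank < r ∧ ∃ S T : Path N v, x = cell b N star ⟨v, S, T⟩}

theorem cellLower_mono (b : ℕ → A) (N : ℕ) (star : A →ₗ[R] A) {r s : ℕ} (h : r ≤ s) :
    cellLower b N star r ≤ cellLower b N star s := by
  refine Submodule.span_mono ?_
  rintro x ⟨v, hv, hx⟩
  exact ⟨v, by omega, hx⟩

namespace Relations

variable {δ : R} {N : ℕ} {b : ℕ → A} {star : A →ₗ[R] A}

theorem star_one (star_star : ∀ a, star (star a) = a)
    (star_mul : ∀ a b, star (a * b) = star b * star a) : star 1 = 1 := by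
  have h := star_mul (star 1) 1
  rw [mul_one, star_star, mul_one] at h
  exact h.symm

theorem star_e (hb : Relations δ N b) (star_star : ∀ a, star (star a) = a)
    (star_mul : ∀ a b, star (a * b) = star b * star a) (star_b : ∀ i < N, star (b i) = b i)
    {n : ℕ} {v : Vertex} (hv : Valid n v) : n ≤ N → star (e b n v) = e b n v := by
  refine Valid.induction (P := fun n v => n ≤ N → star (e b n v) = e b n v) ?_ ?_ hv
  · intro v hv
    rw [e_base]
    split_ifs with h
    · subst h; exact star_b 0 (by simp only [base] at hv; omega)
    · exact star_one star_star star_mul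
  · intro n v hv ih hn
    rw [e_add_two b hv, star_mul, ih (by omega), star_b _ (by omega)]
    exact hb.commute_of_mem_level (Nat.lt_succ_self n) (by omega) (e_mem_level (R := R) b hv)

theorem star_lower (hb : Relations δ N b) (star_star : ∀ a, star (star a) = a)
    (star_mul : ∀ a b, star (a * b) = star b * star a) (star_b : ∀ i < N, star (b i) = b i)
    (htop : level R b N = ⊤) {r : ℕ} {x : A} (hx : x ∈ lower R b N r) :
    star x ∈ lower R b N r := by
  induction hx using Submodule.span_induction with
  | zero => simp
  | add x y _ _ hx hy => rw [map_add]; exact Submodule.add_mem _ hx hy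
  | smul r x _ hx => rw [map_smul]; exact Submodule.smul_mem _ _ hx
  | mem x hx =>
    obtain ⟨w, hw, hr, y, -, z, -, rfl⟩ := hx
    rw [star_mul, star_mul, hb.star_e star_star star_mul star_b hw le_rfl, ← mul_assoc]
    exact mem_lower b hw hr (by simp [htop]) (by simp [htop])

theorem exists_mul_e (hb : Relations δ N b) (htop : level R b N = ⊤) {v : Vertex}
    (hv : Valid N v) (x : A) :
    ∃ c : Path N v → R, x * e b N v - ∑ S, c S • (S.prod b * e b N v) ∈ lower R b N v.rank := by
  obtain ⟨c, hc, l, hl, h⟩ := Submodule.mem_sup.1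
    (hb.mul_e_mem N le_rfl v hv x (by simp [htop]))
  obtain ⟨f, rfl⟩ := (Submodule.mem_span_range_iff_exists_fun R).1 hc
  exact ⟨f, by rwa [← h, add_sub_cancel_left]⟩

/-- Expand `y * e` along walks, then `e * z` along walks after applying `star`, which fixes `e`.
Both errors have fewer through strands, so strong induction on the rank bound closes the argument.
-/
theorem lower_le_cellLower (hb : Relations δ N b) (star_star : ∀ a, star (star a) = a)
    (star_mul : ∀ a b, star (a * b) = star b * star a) (star_b : ∀ i < N, star (b i) = b i)
    (htop : level R b N = ⊤) (r : ℕ) : lower R b N r ≤ cellLower b N star r := by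
  induction r using Nat.strong_induction_on with
  | _ r ih =>
    refine Submodule.span_le.2 ?_
    rintro x ⟨w, hw, hr, y, -, z, -, rfl⟩
    have hlow : ∀ {x : A}, x ∈ lower R b N w.rank → x ∈ cellLower b N star r := fun hx =>
      cellLower_mono b N star hr.le (ih _ hr hx)
    have hmem : ∀ x : A, x ∈ level R b N := fun x => by simp [htop]
    obtain ⟨c, hc⟩ := hb.exists_mul_e htop hw y
    obtain ⟨d, hd⟩ := hb.exists_mul_e htop hw (star z)
    have hd' : e b N w * z - ∑ T, d T • (e b N w * star (Path.prod b T)) ∈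
        lower R b N w.rank := by
      have := hb.star_lower star_star star_mul star_b htop hd
      simpa only [map_sub, map_sum, map_smul, star_mul, star_star,
        hb.star_e star_star star_mul star_b hw le_rfl] using this
    have heq : y * e b N w * z = (y * e b N w - ∑ S, c S • (Path.prod b S * e b N w)) * z +
        ∑ S, c S • (Path.prod b S * (e b N w * z - ∑ T, d T • (e b N w * star (Path.prod b T))) +
          ∑ T, d T • cell b N star ⟨w, S, T⟩) := by
      simp only [sub_mul, mul_sub, Finset.sum_mul, Finset.mul_sum, smul_mul_assoc, mul_smul_comm,
        cell, mul_assoc, sub_add_cancel]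
    rw [SetLike.mem_coe, heq]
    refine Submodule.add_mem _ (hlow (lower_mul_mem b hc (hmem z)))
      (Submodule.sum_mem _ fun S _ => Submodule.smul_mem _ _ (Submodule.add_mem _
        (hlow (mul_mem_lower b hd' (hmem _)))
        (Submodule.sum_mem _ fun T _ => Submodule.smul_mem _ _ ?_)))
    exact Submodule.subset_span ⟨w, hr, S, T, rfl⟩

end Relations

/-- A cell datum for an algebra with the relations of the pair-free Temperley–Lieb algebra, in which
the monomials attached to pairs of walks are linearly independent. -/
theorem Relations.isCellular {R A : Type} [CommRing R] [Nontrivial R] [Ring A] [Algebra R A]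
    {δ : R} {N : ℕ} {b : ℕ → A} {star : A →ₗ[R] A} (hN : 1 ≤ N)
    (hb : Relations δ N b) (star_star : ∀ a, star (star a) = a)
    (star_mul : ∀ a b, star (a * b) = star b * star a) (star_b : ∀ i < N, star (b i) = b i)
    (htop : level R b N = ⊤) (hind : LinearIndependent R (cell b N star)) : IsCellular R A := by
  have hcl := hb.lower_le_cellLower star_star star_mul star_b htop
  refine ⟨{
    Λ := Vertex
    M := Path N
    C := cell b N star
    C_injective := hind.injective
    C_linearIndependent := hind
    C_span := ?_
    star := star
    star_star := star_star
    star_mul := star_mul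
    star_C := ?_
    mul_C := ?_ }⟩
  -- At level `t + 1` the monomial of `pos t` is `1`, so the ideal filtration reaches the whole
  -- algebra.
  · obtain ⟨t, rfl⟩ : ∃ t, N = t + 1 := ⟨N - 1, by omega⟩
    rw [eq_top_iff]
    rintro x -
    have hx := mem_lower (R := R) b (valid_base (pos t)) (Nat.lt_succ_self _)
      (y := x) (by rw [base, htop]; trivial) (one_mem _)
    rw [e_base, if_neg (by simp), mul_one, mul_one] at hx
    refine Submodule.span_mono ?_ (hcl _ hx)
    rintro x ⟨v, -, S, T, rfl⟩
    exact ⟨_, rfl⟩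
  · intro v S T
    simp only [cell, star_mul, star_star, hb.star_e star_star star_mul star_b S.valid le_rfl,
      mul_assoc]
  · intro a v
    -- The expansion takes place before `star (T.prod b)` is multiplied on the right, so its
    -- coefficients do not involve `T`.
    have h : ∀ S : Path N v, ∃ c : Path N v → R, a * S.prod b * e b N v -
        ∑ S', c S' • (S'.prod b * e b N v) ∈ lower R b N v.rank := fun S =>
      hb.exists_mul_e htop S.valid _
    choose c hc using h
    refine ⟨fun S' S => c S S', fun S T => ?_⟩
    have := hcl _ (lower_mul_mem b (hc S) (z := star (T.prod b)) (by rw [htop]; trivial))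
    simp only [sub_mul, Finset.sum_mul, smul_mul_assoc] at this
    simpa only [cell, cellLower, lt_iff_rank_lt, mul_assoc] using this

end Cell

end PairFree

/-! ### Diagram operators on functions of colourings -/

namespace PairFree

open Vertex

/-- Colours: `d` pairs of colours, exchanged by an involution without fixed points. -/
abbrev Colour (d : ℕ) : Type := Fin d × Bool

/-- The involution of the colours. -/
def Colour.bar {d : ℕ} (c : Colour d) : Colour d := (c.1, !c.2)

@[simp] theorem Colour.bar_bar {d : ℕ} (c : Colour d) : c.bar.bar = c := by simp [bar]

theorem Colour.bar_ne {d : ℕ} (c : Colour d) : c.bar ≠ c := by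
  intro h
  have := congrArg Prod.snd h
  simp [bar] at this

@[simp] theorem Colour.bar_fst {d : ℕ} (c : Colour d) : c.bar.1 = c.1 := rfl

/-- A colouring of the strands. -/
abbrev Colouring (d : ℕ) : Type := ℕ → Colour d

namespace Colouring

variable {d : ℕ}

/-- Remove the strands `p` and `p + 1`. -/
def removePair (p : ℕ) (x : Colouring d) : Colouring d := fun i => if i < p then x i else x (i + 2)

/-- Insert two strands at `p` and `p + 1`. -/
def insertPair (p : ℕ) (c c' : Colour d) (x : Colouring d) : Colouring d :=
  fun i => if i < p then x i else if i = p then c else if i = p + 1 then c' else x (i - 2)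

/-- Change the colour of the leftmost strand by the involution. -/
def flipFirst (x : Colouring d) : Colouring d := fun i => if i = 0 then (x 0).bar else x i

@[simp] theorem flip_flip (x : Colouring d) : x.flipFirst.flipFirst = x := by
  funext i; rcases i with _ | i <;> simp [flipFirst]

@[simp] theorem remove_insert (p : ℕ) (c c' : Colour d) (x : Colouring d) :
    (insertPair p c c' x).removePair p = x := by
  funext i; simp only [removePair, insertPair]; grind

theorem insert_remove {p : ℕ} {c : Colour d} {x : Colouring d} (h : x p = c) (h' : x (p + 1) = c) :
    insertPair p c c (x.removePair p) = x := by
  funext i; simp only [removePair, insertPair]; grind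

theorem remove_succ_insert {p : ℕ} {c : Colour d} {x : Colouring d} (h : x p = c) :
    (insertPair p c c x).removePair (p + 1) = x := by
  funext i; simp only [removePair, insertPair]; grind

theorem remove_insert_succ {p : ℕ} {c : Colour d} {x : Colouring d} (h : x p = c) :
    (insertPair (p + 1) c c x).removePair p = x := by
  funext i; simp only [removePair, insertPair]; grind

theorem remove_remove {p q : ℕ} (h : p ≤ q) (x : Colouring d) :
    (x.removePair (q + 2)).removePair p = (x.removePair p).removePair q := by
  funext i; simp only [removePair]; grind

theorem insert_insert {p q : ℕ} (h : p ≤ q) (c c' : Colour d) (x : Colouring d) :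
    insertPair (q + 2) c c (insertPair p c' c' x) = insertPair p c' c' (insertPair q c c x) := by
  funext i; simp only [insertPair]; grind (splits := 20)

theorem remove_insert_add_two {p q : ℕ} (h : p ≤ q) (c : Colour d) (x : Colouring d) :
    (insertPair (q + 2) c c x).removePair p = insertPair q c c (x.removePair p) := by
  funext i; simp only [insertPair, removePair]; grind

theorem remove_add_two_insert {p q : ℕ} (h : p ≤ q) (c : Colour d) (x : Colouring d) :
    (insertPair p c c x).removePair (q + 2) = insertPair p c c (x.removePair q) := by
  funext i; simp only [insertPair, removePair]; grind

end Colouring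

open Colouring

section Operators

variable (R : Type*) [CommRing R] {Q : Type*} [CommRing Q] [Algebra R Q] {d : ℕ}

/-- Creation of a pair of strands. -/
def cup (p : ℕ) : Module.End R (Colouring d → Q) where
  toFun f x := if x p = x (p + 1) then f (x.removePair p) else 0
  map_add' f g := by funext x; simp only [Pi.add_apply]; split_ifs <;> simp
  map_smul' r f := by funext x; simp only [Pi.smul_apply, RingHom.id_apply]; split_ifs <;> simp

/-- Annihilation of a pair of strands. -/
def cap (p : ℕ) : Module.End R (Colouring d → Q) where
  toFun f x := ∑ c, f (insertPair p c c x)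
  map_add' f g := by funext x; simp [Finset.sum_add_distrib]
  map_smul' r f := by funext x; simp [Finset.smul_sum]

/-- The decoration of the leftmost strand. -/
def dot : Module.End R (Colouring d → Q) where
  toFun f x := f x.flipFirst
  map_add' _ _ := rfl
  map_smul' _ _ := rfl

theorem cup_apply (p : ℕ) (f : Colouring d → Q) (x : Colouring d) :
    cup R p f x = if x p = x (p + 1) then f (x.removePair p) else 0 := rfl

theorem cap_apply (p : ℕ) (f : Colouring d → Q) (x : Colouring d) :
    cap R p f x = ∑ c, f (insertPair p c c x) := rfl

theorem dot_apply (f : Colouring d → Q) (x : Colouring d) : dot R f x = f x.flipFirst := rfl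

theorem dot_mul_dot : (dot R * dot R : Module.End R (Colouring d → Q)) = 1 := by
  ext f x; simp [Module.End.mul_apply, dot_apply]

theorem cap_mul_cup (p : ℕ) :
    (cap R p * cup R p : Module.End R (Colouring d → Q)) = ((2 * d : ℕ) : R) • 1 := by
  ext f x
  simp [Module.End.mul_apply, cap_apply, cup_apply, insertPair, Algebra.smul_def, map_ofNat (algebraMap R Q) 2]
  ring

/-- A zigzag is a straight strand: in the sum over colours `c` only `c = x p` survives. -/
theorem cap_mul_cup_succ (p : ℕ) :
    (cap R p * cup R (p + 1) : Module.End R (Colouring d → Q)) = 1 := by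
  ext f x
  have h : ∀ c : Colour d, (if insertPair p c c x (p + 1) = insertPair p c c x (p + 1 + 1) then
      f ((insertPair p c c x).removePair (p + 1)) else 0) = if x p = c then f x else 0 := by
    intro c
    have h1 : insertPair p c c x (p + 1) = c := by simp [insertPair]
    have h2 : insertPair p c c x (p + 1 + 1) = x p := by simp only [insertPair]; grind
    rw [h1, h2]
    by_cases hc : x p = c
    · rw [if_pos hc, if_pos hc.symm, remove_succ_insert hc]
    · rw [if_neg hc, if_neg (Ne.symm hc)]
  simp only [Module.End.mul_apply, cap_apply, cup_apply, h]
  simp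

theorem cap_succ_mul_cup (p : ℕ) :
    (cap R (p + 1) * cup R p : Module.End R (Colouring d → Q)) = 1 := by
  ext f x
  have h : ∀ c : Colour d, (if insertPair (p + 1) c c x p = insertPair (p + 1) c c x (p + 1) then
      f ((insertPair (p + 1) c c x).removePair p) else 0) = if x p = c then f x else 0 := by
    intro c
    have h1 : insertPair (p + 1) c c x (p + 1) = c := by simp [insertPair]
    have h2 : insertPair (p + 1) c c x p = x p := by simp [insertPair]
    rw [h1, h2]
    by_cases hc : x p = c
    · rw [if_pos hc, if_pos hc, remove_insert_succ hc]
    · rw [if_neg hc, if_neg hc]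
  simp only [Module.End.mul_apply, cap_apply, cup_apply, h]
  simp

theorem cup_mul_cup {p q : ℕ} (h : p ≤ q) :
    (cup R (q + 2) * cup R p : Module.End R (Colouring d → Q)) = cup R p * cup R q := by
  ext f x
  simp only [Module.End.mul_apply, cup_apply, remove_remove h]
  have h1 : x.removePair (q + 2) p = x p := by simp only [removePair]; grind
  have h2 : x.removePair (q + 2) (p + 1) = x (p + 1) := by simp only [removePair]; grind
  have h3 : x.removePair p q = x (q + 2) := by simp only [removePair]; grind
  have h4 : x.removePair p (q + 1) = x (q + 2 + 1) := by simp only [removePair]; grind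
  rw [h1, h2, h3, h4]
  split_ifs <;> rfl

theorem cap_mul_cap {p q : ℕ} (h : p ≤ q) :
    (cap R p * cap R (q + 2) : Module.End R (Colouring d → Q)) = cap R q * cap R p := by
  ext f x
  simp only [Module.End.mul_apply, cap_apply, insert_insert h]
  rw [Finset.sum_comm]

theorem cap_add_two_mul_cup {p q : ℕ} (h : p ≤ q) :
    (cap R (q + 2) * cup R p : Module.End R (Colouring d → Q)) = cup R p * cap R q := by
  ext f x
  simp only [Module.End.mul_apply, cap_apply, cup_apply, remove_insert_add_two h]
  have h1 : ∀ c, insertPair (q + 2) c c x p = x p := fun c => by simp only [insertPair]; grind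
  have h2 : ∀ c, insertPair (q + 2) c c x (p + 1) = x (p + 1) := fun c => by
    simp only [insertPair]; grind
  simp only [h1, h2]
  split_ifs <;> simp

theorem cap_mul_cup_add_two {p q : ℕ} (h : p ≤ q) :
    (cap R p * cup R (q + 2) : Module.End R (Colouring d → Q)) = cup R q * cap R p := by
  ext f x
  simp only [Module.End.mul_apply, cap_apply, cup_apply, remove_add_two_insert h]
  have h1 : ∀ c, insertPair p c c x (q + 2) = x q := fun c => by simp only [insertPair]; grind
  have h2 : ∀ c, insertPair p c c x (q + 2 + 1) = x (q + 1) := fun c => by simp only [insertPair]; grind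
  simp only [h1, h2]
  split_ifs <;> simp

theorem dot_mul_cup (p : ℕ) :
    (dot R * cup R (p + 1) : Module.End R (Colouring d → Q)) = cup R (p + 1) * dot R := by
  ext f x
  have h : x.flipFirst.removePair (p + 1) = (x.removePair (p + 1)).flipFirst := by
    funext i; simp only [removePair, flipFirst]; grind
  simp [Module.End.mul_apply, dot_apply, cup_apply, h]
  simp [flipFirst]

theorem dot_mul_cap (p : ℕ) :
    (dot R * cap R (p + 1) : Module.End R (Colouring d → Q)) = cap R (p + 1) * dot R := by
  ext f x
  have h : ∀ c, insertPair (p + 1) c c x.flipFirst = (insertPair (p + 1) c c x).flipFirst := by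
    intro c; funext i; simp only [insertPair, flipFirst]; grind
  simp [Module.End.mul_apply, dot_apply, cap_apply, h]

/-- A circle with one decoration counts the colours fixed by the involution, and there are none.
This realizes the pair-free relation. -/
theorem cap_mul_dot_mul_cup :
    (cap R 0 * dot R * cup R 0 : Module.End R (Colouring d → Q)) = 0 := by
  ext f x
  simp [Module.End.mul_apply, dot_apply, cap_apply, cup_apply, flipFirst, insertPair, Colour.bar_ne]

/-- The operators representing the generators. -/
def gen : ℕ → Module.End R (Colouring d → Q)
  | 0 => dot R * (cup R 0 * cap R 0) * dot R
  | p + 1 => cup R p * cap R p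

theorem gen_zero : (gen R 0 : Module.End R (Colouring d → Q)) = dot R * gen R 1 * dot R := rfl

theorem dot_mul_gen (p : ℕ) :
    (dot R * gen R (p + 2) : Module.End R (Colouring d → Q)) = gen R (p + 2) * dot R := by
  simp only [gen]
  rw [← mul_assoc, dot_mul_cup, mul_assoc, dot_mul_cap, mul_assoc]

theorem gen_mul_cup {p q : ℕ} (h : p ≤ q) :
    (gen R (q + 3) * cup R p : Module.End R (Colouring d → Q)) = cup R p * gen R (q + 1) := by
  simp only [gen]
  rw [mul_assoc, cap_add_two_mul_cup R h, ← mul_assoc, cup_mul_cup R h, mul_assoc]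

theorem cap_mul_gen {p q : ℕ} (h : p ≤ q) :
    (cap R p * gen R (q + 3) : Module.End R (Colouring d → Q)) = gen R (q + 1) * cap R p := by
  simp only [gen]
  rw [← mul_assoc, cap_mul_cup_add_two R h, mul_assoc, cap_mul_cap R h, mul_assoc]

theorem gen_comm {p q : ℕ} (h : p ≤ q) :
    (gen R (p + 1) * gen R (q + 3) : Module.End R (Colouring d → Q)) =
      gen R (q + 3) * gen R (p + 1) := by
  have h1 : (gen R (p + 1) : Module.End R (Colouring d → Q)) = cup R p * cap R p := rfl
  rw [h1, mul_assoc, cap_mul_gen R h, ← mul_assoc, ← gen_mul_cup R h, mul_assoc]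

/-- `gen 0` is the conjugate of `gen 1` by the involution `dot`, which commutes with every `gen (p +
2)`. So the relations of `gen 0` reduce to those of `gen 1`, except for its products with `gen 1`,
which contain a decorated circle. -/
theorem gen_relations (N : ℕ) :
    Relations ((2 * d : ℕ) : R) N (gen R : ℕ → Module.End R (Colouring d → Q)) := by
  have hsq : ∀ i, (gen R (i + 1) * gen R (i + 1) : Module.End R (Colouring d → Q)) =
      ((2 * d : ℕ) : R) • gen R (i + 1) := by
    intro i
    simp only [gen]
    rw [mul_assoc, ← mul_assoc (cap R i), cap_mul_cup, smul_mul_assoc, one_mul, mul_smul_comm]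
  have hbr : ∀ i, (gen R (i + 1) * gen R (i + 2) * gen R (i + 1) :
      Module.End R (Colouring d → Q)) = gen R (i + 1) := by
    intro i
    simp only [gen]
    calc _ = cup R i * (cap R i * cup R (i + 1)) * (cap R (i + 1) * cup R i) * cap R i := by
          simp only [mul_assoc]
      _ = _ := by rw [cap_mul_cup_succ, cap_succ_mul_cup, mul_one, mul_one]
  have hbr' : ∀ i, (gen R (i + 2) * gen R (i + 1) * gen R (i + 2) :
      Module.End R (Colouring d → Q)) = gen R (i + 2) := by
    intro i
    simp only [gen]
    calc _ = cup R (i + 1) * (cap R (i + 1) * cup R i) * (cap R i * cup R (i + 1)) *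
          cap R (i + 1) := by simp only [mul_assoc]
      _ = _ := by rw [cap_mul_cup_succ, cap_succ_mul_cup, mul_one, mul_one]
  have hd : ∀ x : Module.End R (Colouring d → Q), dot R * (dot R * x) = x := by
    intro x; rw [← mul_assoc, dot_mul_dot, one_mul]
  have hone : (gen R 1 * dot R * gen R 1 : Module.End R (Colouring d → Q)) = 0 := by
    simp only [gen]
    calc _ = cup R 0 * (cap R 0 * dot R * cup R 0) * cap R 0 := by simp only [mul_assoc]
      _ = 0 := by rw [cap_mul_dot_mul_cup, mul_zero, zero_mul]
  constructor
  · rintro (_ | i) -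
    · rw [gen_zero]
      calc _ = dot R * gen R 1 * (dot R * (dot R * (gen R 1 * dot R))) := by simp only [mul_assoc]
        _ = dot R * (gen R 1 * gen R 1) * dot R := by rw [hd]; simp only [mul_assoc]
        _ = _ := by rw [hsq, mul_smul_comm, smul_mul_assoc]
    · exact hsq i
  · rintro (_ | i) j hij - h
    · obtain ⟨j, rfl⟩ : ∃ k, j = k + 3 := ⟨j - 3, by omega⟩
      have h1 := gen_comm R (Q := Q) (d := d) (Nat.zero_le j)
      have h2 := dot_mul_gen R (Q := Q) (d := d) (j + 1)
      rw [gen_zero]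
      calc _ = dot R * gen R 1 * (dot R * gen R (j + 1 + 2)) := by simp only [mul_assoc]
        _ = dot R * (gen R (0 + 1) * gen R (j + 3)) * dot R := by rw [h2]; simp only [mul_assoc]
        _ = (dot R * gen R (j + 1 + 2)) * gen R 1 * dot R := by rw [h1]; simp only [mul_assoc]
        _ = _ := by rw [h2]; simp only [mul_assoc]
    · obtain ⟨j, rfl⟩ : ∃ k, j = k + 3 := ⟨j - 3, by omega⟩
      exact gen_comm R (by omega)
  · rw [gen_zero]
    calc _ = dot R * (gen R 1 * dot R * gen R 1) := by simp only [mul_assoc]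
      _ = 0 := by rw [hone, mul_zero]
  · rw [gen_zero]
    calc _ = (gen R 1 * dot R * gen R 1) * dot R := by simp only [mul_assoc]
      _ = 0 := by rw [hone, zero_mul]
  · intro i hi _
    obtain ⟨i, rfl⟩ : ∃ k, i = k + 1 := ⟨i - 1, by omega⟩
    exact hbr i
  · intro i hi _
    obtain ⟨i, rfl⟩ : ∃ k, i = k + 1 := ⟨i - 1, by omega⟩
    exact hbr' i
  · have h2 := dot_mul_gen R (Q := Q) (d := d) 0
    rw [gen_zero]
    calc _ = dot R * gen R 1 * (dot R * gen R (0 + 2)) * (dot R * (gen R 1 * dot R)) := by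
          simp only [mul_assoc]
      _ = dot R * (gen R (0 + 1) * gen R (0 + 2) * gen R (0 + 1)) * dot R := by
          rw [h2]; simp only [mul_assoc, hd]
      _ = _ := by rw [hbr]
  · have h2 := dot_mul_gen R (Q := Q) (d := d) 0
    rw [gen_zero]
    calc _ = (gen R (0 + 2) * dot R) * gen R 1 * (dot R * gen R (0 + 2)) := by
          simp only [mul_assoc]
      _ = dot R * (gen R (0 + 2) * gen R (0 + 1) * gen R (0 + 2)) * dot R := by
          rw [h2, ← h2]; simp only [mul_assoc]; rw [h2]
      _ = gen R (0 + 2) := by rw [hbr', mul_assoc, ← h2, hd]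

/-- The decoration that belongs to a vertex. -/
def twist (v : Vertex) : Module.End R (Colouring d → Q) := if v = odd then dot R else 1

theorem twist_up (v : Vertex) : (twist R v.up : Module.End R (Colouring d → Q)) = 1 := by
  cases v <;> simp [twist, Vertex.up]

theorem twist_mul_cup_pow (v : Vertex) (p k : ℕ) :
    (twist R v * cup R (p + 1) ^ k : Module.End R (Colouring d → Q)) =
      cup R (p + 1) ^ k * twist R v := by
  unfold twist
  split_ifs
  · exact (Commute.pow_right (dot_mul_cup R p) k)
  · simp

theorem twist_mul_cap_pow (v : Vertex) (p k : ℕ) :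
    (twist R v * cap R (p + 1) ^ k : Module.End R (Colouring d → Q)) =
      cap R (p + 1) ^ k * twist R v := by
  unfold twist
  split_ifs
  · exact (Commute.pow_right (dot_mul_cap R p) k)
  · simp

theorem cap_pow_mul_cup_succ_pow (p k : ℕ) :
    (cap R p ^ k * cup R (p + 1) ^ k : Module.End R (Colouring d → Q)) = 1 := by
  induction k with
  | zero => simp
  | succ k ih =>
    rw [pow_succ, pow_succ', mul_assoc, ← mul_assoc (cap R p), cap_mul_cup_succ, one_mul, ih]

theorem cap_succ_pow_mul_cup_pow (p k : ℕ) :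
    (cap R (p + 1) ^ k * cup R p ^ k : Module.End R (Colouring d → Q)) = 1 := by
  induction k with
  | zero => simp
  | succ k ih =>
    rw [pow_succ, pow_succ', mul_assoc, ← mul_assoc (cap R (p + 1)), cap_succ_mul_cup, one_mul, ih]

theorem gen_mul_cup_pow (p k : ℕ) :
    (gen R (p + 2 * k + 1) * cup R p ^ k : Module.End R (Colouring d → Q)) =
      cup R p ^ k * gen R (p + 1) := by
  induction k with
  | zero => simp
  | succ k ih =>
    rw [pow_succ', ← mul_assoc, show p + 2 * (k + 1) + 1 = p + 2 * k + 3 by ring,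
      gen_mul_cup R (by omega), mul_assoc, ih, mul_assoc]

/-- The monomial factors into an upper and a lower half-diagram. Powers of `cup` at one position
produce adjacent arcs, because the removal of a pair moves the next pair to the same position. -/
theorem e_gen {n : ℕ} {v : Vertex} (h : Valid n v) :
    (e (gen R) n v : Module.End R (Colouring d → Q)) =
      twist R v * cup R v.rank ^ ((n - v.rank) / 2) *
        (cap R v.rank ^ ((n - v.rank) / 2) * twist R v) := by
  refine Valid.induction (P := fun n v => (e (gen R) n v : Module.End R (Colouring d → Q)) =
      twist R v * cup R v.rank ^ ((n - v.rank) / 2) *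
        (cap R v.rank ^ ((n - v.rank) / 2) * twist R v)) ?_ ?_ h
  · intro v
    rw [e_base]
    rcases v with _ | _ | t <;> simp [twist, base, rank, gen, mul_assoc]
  · intro n v hv ih
    obtain ⟨k, hk⟩ : ∃ k, n = v.rank + 2 * k := by
      refine ⟨(n - v.rank) / 2, ?_⟩
      cases v <;> simp only [Valid, base, rank] at * <;> omega
    have hk1 : (n - v.rank) / 2 = k := by omega
    have hk2 : (n + 2 - v.rank) / 2 = k + 1 := by omega
    have ht : (gen R (n + 1) * twist R v : Module.End R (Colouring d → Q)) =
        twist R v * gen R (n + 1) := by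
      unfold twist
      split_ifs with hodd
      · subst hodd
        obtain ⟨m, rfl⟩ : ∃ m, n = m + 1 := ⟨n - 1, by have := hv.1; simp only [base] at this; omega⟩
        exact (dot_mul_gen R m).symm
      · simp
    rw [e_add_two _ hv, ih, hk1, hk2]
    rw [← mul_assoc, ← mul_assoc (gen R (n + 1)), ht, mul_assoc (twist R v), hk, gen_mul_cup_pow, pow_succ,
      pow_succ']
    simp only [gen, mul_assoc]

/-- The reversed product of the monomials attached to the vertices of a walk. -/
def Path.prodRev {A : Type*} [Ring A] (b : ℕ → A) : ∀ {n : ℕ} {v : Vertex}, Path n v → A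
  | _, _, .nil => 1
  | _, _, .up (n := n) (v := v) _ p => e b n v * p.prodRev b
  | _, _, .down (n := n) (v := v) p => e b n v.up * p.prodRev b

/-- The operator creating the half-diagram of a walk. -/
def Path.col : ∀ {n : ℕ} {v : Vertex}, Path n v → Module.End R (Colouring d → Q)
  | _, _, .nil => 1
  | _, _, .up (v := v) _ p => p.col * twist R v
  | _, _, .down (v := v) p => p.col * (twist R v * cup R v.rank)

/-- The operator annihilating the half-diagram of a walk. -/
def Path.row : ∀ {n : ℕ} {v : Vertex}, Path n v → Module.End R (Colouring d → Q)
  | _, _, .nil => 1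
  | _, _, .up (v := v) _ p => twist R v * p.row
  | _, _, .down (v := v) p => cap R v.rank * twist R v * p.row

/-- The product telescopes: the caps of each monomial straighten against the cups of the next one. A
step up leaves only the decoration of the vertex it starts from, and a step down leaves one cup with
the decoration of the vertex it reaches. -/
theorem Path.prod_gen {n : ℕ} {v : Vertex} (p : Path n v) :
    (p.prod (gen R) : Module.End R (Colouring d → Q)) *
      (twist R v * cup R v.rank ^ ((n - v.rank) / 2)) = p.col R := by
  induction p with
  | nil => simp [Path.prod, Path.col, twist, rank]
  | @up n v w h p ih =>
    subst h
    rw [Path.prod, Path.col, twist_up, rank_up, one_mul, e_gen R p.valid, ← ih,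
      show (n + 1 - (v.rank + 1)) = n - v.rank by omega]
    simp only [mul_assoc]
    rw [twist_mul_cup_pow, ← mul_assoc (cap R _ ^ _), cap_pow_mul_cup_succ_pow, one_mul]
  | @down n v p ih =>
    have hv := p.valid
    obtain ⟨k, hk⟩ : ∃ k, n = v.rank + 1 + 2 * k := by
      refine ⟨(n - v.rank) / 2, ?_⟩
      cases v <;> simp only [Valid, base, rank, Vertex.up] at * <;> omega
    have h1 : (n - (v.rank + 1)) / 2 = k := by omega
    have h2 : (n + 1 - v.rank) / 2 = k + 1 := by omega
    rw [twist_up, one_mul, rank_up, h1] at ih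
    rw [Path.prod, Path.col, e_gen R p.valid, twist_up, rank_up, one_mul, mul_one, h1, h2, ← ih]
    simp only [mul_assoc]
    rw [← mul_assoc (cap R _ ^ _), ← twist_mul_cap_pow, mul_assoc, pow_succ (cup R v.rank),
      ← mul_assoc (cap R _ ^ _), cap_succ_pow_mul_cup_pow, one_mul]

theorem Path.prodRev_gen {n : ℕ} {v : Vertex} (p : Path n v) :
    cap R v.rank ^ ((n - v.rank) / 2) * twist R v *
      (p.prodRev (gen R) : Module.End R (Colouring d → Q)) = p.row R := by
  induction p with
  | nil => simp [Path.prodRev, Path.row, twist, rank]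
  | @up n v w h p ih =>
    subst h
    rw [Path.prodRev, Path.row, twist_up, rank_up, mul_one, e_gen R p.valid, ← ih,
      show (n + 1 - (v.rank + 1)) = n - v.rank by omega]
    simp only [← mul_assoc]
    rw [← twist_mul_cap_pow, mul_assoc (twist R v), cap_succ_pow_mul_cup_pow, mul_one]
  | @down n v p ih =>
    have hv := p.valid
    obtain ⟨k, hk⟩ : ∃ k, n = v.rank + 1 + 2 * k := by
      refine ⟨(n - v.rank) / 2, ?_⟩
      cases v <;> simp only [Valid, base, rank, Vertex.up] at * <;> omega
    have h1 : (n - (v.rank + 1)) / 2 = k := by omega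
    have h2 : (n + 1 - v.rank) / 2 = k + 1 := by omega
    rw [twist_up, mul_one, rank_up, h1] at ih
    rw [Path.prodRev, Path.row, e_gen R p.valid, twist_up, rank_up, one_mul, mul_one, h1, h2, ← ih]
    simp only [← mul_assoc]
    rw [mul_assoc (cap R _ ^ _) (twist R v), twist_mul_cup_pow, ← mul_assoc, pow_succ' (cap R v.rank),
      mul_assoc (cap R v.rank), cap_pow_mul_cup_succ_pow, mul_one]

theorem prod_mul_e_mul_prodRev {n : ℕ} {v : Vertex} (S T : Path n v) :
    (S.prod (gen R) * e (gen R) n v * T.prodRev (gen R) : Module.End R (Colouring d → Q)) =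
      S.col R * T.row R := by
  rw [← S.prod_gen R, ← T.prodRev_gen R, e_gen R S.valid]
  simp only [mul_assoc]

end Operators

end PairFree

/-! ### Recovering a walk from a colouring -/

namespace PairFree

open Vertex Colouring

section Reading

variable {d : ℕ}

/-- The decoration that belongs to a vertex, on colourings. -/
def Colouring.twist (v : Vertex) (x : Colouring d) : Colouring d :=
  if v = odd then x.flipFirst else x

@[simp] theorem Colouring.twist_twist (v : Vertex) (x : Colouring d) :
    (x.twist v).twist v = x := by
  unfold Colouring.twist; split_ifs <;> simp

@[simp] theorem Colouring.twist_apply_fst (v : Vertex) (x : Colouring d) (i : ℕ) :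
    (x.twist v i).1 = (x i).1 := by
  unfold Colouring.twist
  split_ifs
  · rcases i with _ | i <;> simp [flipFirst]
  · rfl

@[simp] theorem Colouring.twist_apply_succ (v : Vertex) (x : Colouring d) (i : ℕ) :
    x.twist v (i + 1) = x (i + 1) := by
  unfold Colouring.twist
  split_ifs <;> simp [flipFirst]

/-- Match the colouring against the half-diagram of a walk: the result has the colours of the
through strands, followed by the unused colours. -/
def Path.read : ∀ {n : ℕ} {v : Vertex}, Path n v → Colouring d → Option (Colouring d)
  | _, _, .nil, x => some x
  | _, _, .up (v := v) _ p, x => (p.read x).map (Colouring.twist v)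
  | _, _, .down (v := v) p, x => (p.read x).bind fun w =>
      if w.twist v v.rank = w.twist v (v.rank + 1) then some ((w.twist v).removePair v.rank)
      else none

/-- A colouring that matches the half-diagram of a walk, with a new colour for each arc. -/
def Path.lift (c : ℕ → Fin d) : ∀ {n : ℕ} {v : Vertex}, Path n v → Colouring d → Colouring d
  | _, _, .nil, z => z
  | _, _, .up (v := v) _ p, z => p.lift c (z.twist v)
  | _, _, .down (n := n) (v := v) p, z =>
      p.lift c ((insertPair v.rank (c n, false) (c n, false) z).twist v)

theorem Path.read_lift (c : ℕ → Fin d) {n : ℕ} {v : Vertex} (p : Path n v) (z : Colouring d) :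
    p.read (p.lift c z) = some z := by
  induction p generalizing z with
  | nil => rfl
  | up h p ih => simp [Path.read, Path.lift, ih]
  | down p ih => simp [Path.read, Path.lift, ih, insertPair]

/-- A walk of length `n` touches only the first `n` strands; the later colours are shifted behind
the through strands. -/
theorem Path.read_apply_add {n : ℕ} {v : Vertex} (p : Path n v) {x w : Colouring d}
    (h : p.read x = some w) (i : ℕ) : w (v.rank + i) = x (n + i) := by
  induction p generalizing w i with
  | nil => simp only [Path.read, Option.some.injEq] at h; subst h; simp [rank]
  | @up n v u hu p ih =>
    subst hu
    obtain ⟨w, hw, rfl⟩ := Option.map_eq_some_iff.1 h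
    have := ih hw (i + 1)
    rw [rank_up, show v.rank + 1 + i = v.rank + i + 1 by ring, Colouring.twist_apply_succ,
      show n + 1 + i = n + (i + 1) by ring, ← this, add_assoc]
  | @down n v p ih =>
    obtain ⟨w', hw, h⟩ := Option.bind_eq_some_iff.1 h
    split_ifs at h with hc
    simp only [Option.some.injEq] at h
    subst h
    have := ih hw (i + 1)
    rw [rank_up] at this
    rw [show n + 1 + i = n + (i + 1) by ring, ← this]
    simp only [removePair, if_neg (Nat.not_lt.2 (Nat.le_add_right _ _)),
      Colouring.twist_apply_succ]
    congr 1
    ring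

theorem Path.exists_of_read {n : ℕ} {v : Vertex} (p : Path n v) {x w : Colouring d}
    (h : p.read x = some w) {j : ℕ} (hj : j < v.rank) : ∃ i < n, (w j).1 = (x i).1 := by
  induction p generalizing w j with
  | nil => simp [rank] at hj
  | @up n v u hu p ih =>
    subst hu
    obtain ⟨w, hw, rfl⟩ := Option.map_eq_some_iff.1 h
    rw [rank_up] at hj
    rcases (by omega : j < v.rank ∨ j = v.rank) with hj | rfl
    · obtain ⟨i, hi, h⟩ := ih hw hj
      exact ⟨i, by omega, by simpa using h⟩
    · exact ⟨n, by omega, by simpa using congrArg Prod.fst (p.read_apply_add hw 0)⟩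
  | @down n v p ih =>
    obtain ⟨w', hw, h⟩ := Option.bind_eq_some_iff.1 h
    split_ifs at h with hc
    simp only [Option.some.injEq] at h
    subst h
    obtain ⟨i, hi, h⟩ := ih hw (j := j) (by rw [rank_up]; omega)
    exact ⟨i, by omega, by simpa [removePair, hj] using h⟩

theorem Path.lift_apply (c : ℕ → Fin d) {n : ℕ} {v : Vertex} (p : Path n v) (z : Colouring d)
    {i : ℕ} (hi : i < n) :
    (∃ j < v.rank, (p.lift c z i).1 = (z j).1) ∨ ∃ m < n, (p.lift c z i).1 = c m := by
  induction p generalizing z with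
  | nil => omega
  | @up n v u hu p ih =>
    subst hu
    rw [Path.lift]
    rcases (by omega : i < n ∨ i = n) with hi | rfl
    · rcases ih (z.twist v) hi with ⟨j, hj, h⟩ | ⟨m, hm, h⟩
      · exact Or.inl ⟨j, by rw [rank_up]; omega, by simpa using h⟩
      · exact Or.inr ⟨m, by omega, h⟩
    · refine Or.inl ⟨v.rank, by simp, ?_⟩
      have := congrArg Prod.fst (p.read_apply_add (p.read_lift c (z.twist v)) 0)
      simpa using this.symm
  | @down n v p ih =>
    rw [Path.lift]
    rcases (by omega : i < n ∨ i = n) with hi | rfl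
    · rcases ih ((insertPair v.rank (c n, false) (c n, false) z).twist v) hi with ⟨j, hj, h⟩ | ⟨m, hm, h⟩
      · rw [rank_up] at hj
        rw [Colouring.twist_apply_fst] at h
        rcases (by omega : j < v.rank ∨ j = v.rank) with hj | rfl
        · exact Or.inl ⟨j, hj, by simpa [insertPair, hj] using h⟩
        · exact Or.inr ⟨n, by omega, by simpa [insertPair] using h⟩
      · exact Or.inr ⟨m, by omega, h⟩
    · refine Or.inr ⟨i, by omega, ?_⟩
      have := congrArg Prod.fst (p.read_apply_add (p.read_lift c
        ((insertPair v.rank (c i, false) (c i, false) z).twist v)) 0)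
      rw [rank_up] at this
      simpa [insertPair] using this.symm

/-- The first `r` colours are pairwise different and differ from the first `n` terms of `c`. -/
structure Fresh (c : ℕ → Fin d) (n r : ℕ) (z : Colouring d) : Prop where
  ne_color : ∀ i < r, ∀ m < n, (z i).1 ≠ c m
  ne : ∀ i j, i < j → j < r → (z i).1 ≠ (z j).1

/-- Triangularity. Compare last steps. A new through strand of `p` has a colour absent from the
earlier strands, so `q` cannot close it. If `p` closes an arc and `q` does not, the walks without
their last steps agree by induction, and `q` would have more through strands than `p`. Only colours
up to the involution matter until the end, where `even` and `odd` must be told apart. -/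
theorem Path.eq_of_read_lift {c : ℕ → Fin d} {N : ℕ} (hc : Set.InjOn c (Set.Iio N)) {n : ℕ}
    {v : Vertex} (p : Path n v) (hn : n ≤ N) (z : Colouring d) (hz : Fresh c n v.rank z)
    {v' : Vertex} (q : Path n v') {w : Colouring d} (hq : q.read (p.lift c z) = some w)
    (hr : v'.rank ≤ v.rank) : (⟨v', q⟩ : Σ v, Path n v) = ⟨v, p⟩ := by
  induction p generalizing z v' w with
  | nil => cases q; rfl
  | @up n v u hu p ih =>
    subst hu
    rw [rank_up] at hz hr
    have hz0 : Fresh c n v.rank (z.twist v) :=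
      ⟨fun i hi m hm => by simpa using hz.ne_color i (by omega) m (by omega),
        fun i j hij hj => by simpa using hz.ne i j hij (by omega)⟩
    cases q with
    | @up _ v0 _ h q =>
      subst h
      obtain ⟨w, hw, -⟩ := Option.map_eq_some_iff.1 hq
      rw [rank_up] at hr
      have := ih (by omega) _ hz0 q hw (by omega)
      cases this
      rfl
    | down q =>
      exfalso
      obtain ⟨w0, hw, h⟩ := Option.bind_eq_some_iff.1 hq
      split_ifs at h with he
      have he := congrArg Prod.fst he
      rw [Colouring.twist_apply_fst, Colouring.twist_apply_fst] at he
      have h1 := q.read_apply_add hw 0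
      have h2 := p.read_apply_add (p.read_lift c (z.twist v)) 0
      rw [rank_up] at h1
      simp only [add_zero] at h1 h2
      rw [h1] at he
      change _ = (p.lift c (z.twist v) n).1 at he
      rw [← h2, Colouring.twist_apply_fst] at he
      obtain ⟨i, hi, h3⟩ := q.exists_of_read hw (j := v'.rank) (by simp)
      change _ = (p.lift c (z.twist v) i).1 at h3
      rcases p.lift_apply c (z.twist v) hi with ⟨j, hj, h4⟩ | ⟨m, hm, h4⟩
      · rw [Colouring.twist_apply_fst] at h4
        exact hz.ne j v.rank hj (by omega) (by rw [← h4, ← h3, he])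
      · exact hz.ne_color v.rank (by omega) m (by omega) (by rw [← he, h3, h4])
  | @down n v p ih =>
    set z0 := (insertPair v.rank (c n, false) (c n, false) z).twist v with hz0'
    have hlt : ∀ i < v.rank, (z0 i).1 = (z i).1 := fun i hi => by simp [hz0', insertPair, hi]
    have heq : (z0 v.rank).1 = c n := by simp [hz0', insertPair]
    have hz0 : Fresh c n v.up.rank z0 := by
      rw [rank_up]
      constructor
      · intro i hi m hm
        rcases (by omega : i < v.rank ∨ i = v.rank) with hi | rfl
        · rw [hlt i hi]; exact hz.ne_color i hi m (by omega)
        · rw [heq]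
          intro h
          have := hc (show n ∈ Set.Iio N from by simp; omega) (show m ∈ Set.Iio N from by simp; omega) h
          omega
      · intro i j hij hj
        rcases (by omega : j < v.rank ∨ j = v.rank) with hj | rfl
        · rw [hlt i (by omega), hlt j hj]; exact hz.ne i j hij hj
        · rw [hlt i hij, heq]; exact hz.ne_color i hij n (by omega)
    cases q with
    | @up _ v0 _ h q =>
      subst h
      obtain ⟨w, hw, -⟩ := Option.map_eq_some_iff.1 hq
      rw [rank_up] at hr
      have := congrArg (fun s => s.1.rank) (ih (by omega) _ hz0 q hw (by rw [rank_up]; omega))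
      simp only [rank_up] at this
      omega
    | down q =>
      obtain ⟨w0, hw, h⟩ := Option.bind_eq_some_iff.1 hq
      split_ifs at h with he
      have hqp := ih (by omega) _ hz0 q hw (by rw [rank_up, rank_up]; omega)
      have hw0 : w0 = z0 := by
        have h1 : ∀ s : Σ v, Path n v, s = ⟨v.up, p⟩ → s.2.read (p.lift c z0) = some z0 := by
          rintro _ rfl; exact p.read_lift c z0
        have h2 := h1 _ hqp
        rw [show (Sigma.snd ⟨v'.up, q⟩ : Path n v'.up).read (p.lift c z0) = some w0 from hw] at h2
        simpa using h2
      -- `v'.up = v.up` leaves only `even` against `odd`. A wrong decoration would require a colour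
      -- to equal its own image under the involution.
      have hv : v' = v := by
        have hup : v'.up = v.up := congrArg Sigma.fst hqp
        subst hw0
        have hb := Colour.bar_ne (c n, false)
        rcases v with _ | _ | t <;> rcases v' with _ | _ | t' <;>
          simp_all [Vertex.up, Colouring.twist, rank, flipFirst, insertPair]
      subst hv
      rw [Sigma.mk.injEq] at hqp
      rw [eq_of_heq hqp.2]

end Reading

section Evaluation

variable (R : Type*) [CommRing R] {Q : Type*} [CommRing Q] [Algebra R Q] {d : ℕ}

theorem twist_apply (v : Vertex) (f : Colouring d → Q) (x : Colouring d) :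
    twist R v f x = f (x.twist v) := by
  unfold twist Colouring.twist
  split_ifs <;> rfl

open Classical in
/-- The indicator function of a colouring, or zero. -/
noncomputable def indicator (Q : Type*) [CommRing Q] (o : Option (Colouring d)) :
    Colouring d → Q := fun z => if o = some z then 1 else 0

/-- `col` is pullback along the partial map `read`, while `row` pushes point masses forward along
it. The matrix entries of `col * row` therefore only ask whether two readings agree. -/
theorem Path.col_apply {n : ℕ} {v : Vertex} (p : Path n v) (f : Colouring d → Q)
    (x : Colouring d) : p.col R f x = (p.read x).elim 0 f := by
  induction p generalizing f with
  | nil => rfl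
  | up h p ih =>
    rw [Path.col, Module.End.mul_apply, ih, Path.read]
    cases p.read x with
    | none => rfl
    | some w => simp [twist_apply]
  | down p ih =>
    rw [Path.col, Module.End.mul_apply, ih, Path.read]
    cases p.read x with
    | none => rfl
    | some w =>
      simp only [Option.elim_some, Option.bind_some, Module.End.mul_apply, twist_apply, cup_apply]
      split_ifs <;> rfl

theorem twist_indicator (v : Vertex) (o : Option (Colouring d)) :
    twist R v (indicator Q o) = indicator Q (o.map (Colouring.twist v)) := by
  funext z
  rw [twist_apply]
  unfold indicator
  cases o with
  | none => simp
  | some w =>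
    have : w = z.twist v ↔ w.twist v = z :=
      ⟨fun h => by rw [h, Colouring.twist_twist], fun h => by rw [← h, Colouring.twist_twist]⟩
    rw [Option.map_some]
    classical
    exact if_congr (by rw [Option.some_inj, Option.some_inj, this]) rfl rfl

theorem cap_indicator (p : ℕ) (w : Colouring d) :
    cap R p (indicator Q (some w)) =
      indicator Q (if w p = w (p + 1) then some (w.removePair p) else none) := by
  funext z
  rw [cap_apply]
  unfold indicator
  have h : ∀ c, some w = some (insertPair p c c z) ↔
      c = w p ∧ w p = w (p + 1) ∧ w.removePair p = z := by
    intro c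
    rw [Option.some_inj]
    constructor
    · rintro rfl
      simp [insertPair]
    · rintro ⟨rfl, h1, rfl⟩
      exact (insert_remove rfl h1.symm).symm
  by_cases h1 : w p = w (p + 1) <;> by_cases h2 : w.removePair p = z <;> simp [h, h1, h2]

theorem Path.row_apply {n : ℕ} {v : Vertex} (p : Path n v) (y : Colouring d) :
    p.row R (indicator Q (some y)) = indicator Q (p.read y) := by
  induction p with
  | nil => rfl
  | up h p ih => rw [Path.row, Module.End.mul_apply, ih, twist_indicator, Path.read]
  | down p ih =>
    rw [Path.row, Module.End.mul_apply, ih, Module.End.mul_apply, twist_indicator, Path.read]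
    cases p.read y with
    | none =>
      have h : indicator Q (none : Option (Colouring d)) = 0 := by funext z; simp [indicator]
      simp [h]
    | some w => simp [cap_indicator]

end Evaluation

/-! ### Isolating a coefficient of a linear relation -/

section Independence

variable {R A : Type*} [CommRing R] [Ring A] [Algebra R A]

theorem map_e {B : Type*} [Ring B] [Algebra R B] (ρ : A →ₐ[R] B) {b : ℕ → A} {b' : ℕ → B} {N : ℕ}
    (h : ∀ i < N, ρ (b i) = b' i) {n : ℕ} {v : Vertex} (hv : Valid n v) :
    n ≤ N → ρ (e b n v) = e b' n v := by
  refine Valid.induction (P := fun n v => n ≤ N → ρ (e b n v) = e b' n v) ?_ ?_ hv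
  · intro v hv
    rw [e_base, e_base]
    split_ifs with hodd
    · subst hodd; exact h 0 (by simp only [base] at hv; omega)
    · exact map_one ρ
  · intro n v hv ih hn
    rw [e_add_two _ hv, e_add_two _ hv, map_mul, ih (by omega), h _ (by omega)]

theorem Path.map_prod {B : Type*} [Ring B] [Algebra R B] (ρ : A →ₐ[R] B) {b : ℕ → A} {b' : ℕ → B} {N : ℕ}
    (h : ∀ i < N, ρ (b i) = b' i) {n : ℕ} {v : Vertex} (p : Path n v) (hn : n ≤ N) :
    ρ (p.prod b) = p.prod b' := by
  induction p with
  | nil => exact map_one ρ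
  | up _ p ih | down p ih =>
    rw [Path.prod, Path.prod, map_mul, ih (by omega), map_e ρ h p.valid (by omega)]

theorem Path.map_prodRev {B : Type*} [Ring B] [Algebra R B] (ρ : A →ₐ[R] B) {b : ℕ → A} {b' : ℕ → B} {N : ℕ}
    (h : ∀ i < N, ρ (b i) = b' i) {n : ℕ} {v : Vertex} (p : Path n v) (hn : n ≤ N) :
    ρ (p.prodRev b) = p.prodRev b' := by
  induction p with
  | nil => exact map_one ρ
  | up _ p ih | down p ih =>
    rw [Path.prodRev, Path.prodRev, map_mul, ih (by omega), map_e ρ h p.valid (by omega)]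

theorem Relations.star_prod {δ : R} {N : ℕ} {b : ℕ → A} {star : A →ₗ[R] A}
    (hb : Relations δ N b) (star_star : ∀ a, star (star a) = a)
    (star_mul : ∀ a b, star (a * b) = star b * star a) (star_b : ∀ i < N, star (b i) = b i)
    {n : ℕ} {v : Vertex} (p : Path n v) (hn : n ≤ N) : star (p.prod b) = p.prodRev b := by
  induction p with
  | nil => exact star_one star_star star_mul
  | up _ p ih | down p ih =>
    rw [Path.prod, Path.prodRev, star_mul, ih (by omega),
      hb.star_e star_star star_mul star_b p.valid (by omega)]

/-- In a linear relation between the basis elements, a coefficient with the largest number of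
through strands vanishes after specialization. -/
theorem Relations.smul_one_eq_zero {δ : R} {N d : ℕ} {b : ℕ → A} {star : A →ₗ[R] A}
    (hb : Relations δ N b) (star_star : ∀ a, star (star a) = a)
    (star_mul : ∀ a b, star (a * b) = star b * star a) (star_b : ∀ i < N, star (b i) = b i)
    {Q : Type*} [CommRing Q] [Algebra R Q] (ρ : A →ₐ[R] Module.End R (Colouring d → Q))
    (hρ : ∀ i < N, ρ (b i) = gen R i) (hd : 2 * N < d)
    (s : Finset (Σ v, Path N v × Path N v)) (g : (Σ v, Path N v × Path N v) → R)
    (hs : ∑ i ∈ s, g i • cell b N star i = 0) {i : Σ v, Path N v × Path N v} (hi : i ∈ s)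
    (hmax : ∀ j ∈ s, g j ≠ 0 → j.1.rank ≤ i.1.rank) : g i • (1 : Q) = 0 := by
  have hcell : ∀ j : Σ v, Path N v × Path N v,
      ρ (cell b N star j) = j.2.1.col R * j.2.2.row R := by
    rintro ⟨v, S, T⟩
    rw [cell, map_mul, map_mul, hb.star_prod star_star star_mul star_b T le_rfl,
      ← prod_mul_e_mul_prodRev]
    congr 1
    · congr 1
      · exact S.map_prod ρ hρ le_rfl
      · exact map_e ρ hρ S.valid le_rfl
    · exact T.map_prodRev ρ hρ le_rfl
  obtain ⟨v, S, T⟩ := i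
  -- Since `2 * N < d`, reduction modulo `d` is injective on the indices used: those below `N`
  -- colour arcs, and `N + m` colours the through strand `m`.
  let c : ℕ → Fin d := fun m => ⟨m % d, Nat.mod_lt _ (by omega)⟩
  have hc : Set.InjOn c (Set.Iio (2 * N + 1)) := by
    intro m hm m' hm' h
    simp only [Set.mem_Iio] at hm hm'
    have := congrArg Fin.val h
    simp only [c] at this
    rwa [Nat.mod_eq_of_lt (by omega), Nat.mod_eq_of_lt (by omega)] at this
  have hrank : v.rank ≤ N := by
    have := S.valid.1
    cases v <;> simp only [base, rank] at * <;> omega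
  let z : Colouring d := fun m => (c (N + m), false)
  have hz : Fresh c N v.rank z := by
    constructor
    · intro i hi m hm h
      have := hc (show N + i ∈ Set.Iio (2 * N + 1) by simp; omega)
        (show m ∈ Set.Iio (2 * N + 1) by simp; omega) h
      omega
    · intro i j hij hj h
      have := hc (show N + i ∈ Set.Iio (2 * N + 1) by simp; omega)
        (show N + j ∈ Set.Iio (2 * N + 1) by simp; omega) h
      omega
  -- Take the matrix entry of the relation at the two lifted colourings. By triangularity and
  -- maximality of the rank only the term of `(S, T)` contributes, and its entry is `1`.
  have h0 := congrArg (fun a => ρ a (indicator Q (some (T.lift c z))) (S.lift c z)) hs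
  simp only [map_sum, map_smul, map_zero, hcell, LinearMap.sum_apply, LinearMap.smul_apply,
    Finset.sum_apply, Pi.smul_apply, Module.End.mul_apply, Path.row_apply, Path.col_apply,
    LinearMap.zero_apply, Pi.zero_apply] at h0
  rw [Finset.sum_eq_single_of_mem _ hi] at h0
  · simpa [Path.read_lift, indicator] using h0
  · rintro ⟨v', S', T'⟩ hj hne
    by_cases hg : g ⟨v', S', T'⟩ = 0
    · rw [hg, zero_smul]
    · have hr := hmax _ hj hg
      rcases hS : S'.read (S.lift c z) with _ | w
      · simp
      rcases hT : T'.read (T.lift c z) with _ | w'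
      · simp [indicator]
      · exfalso
        apply hne
        have h1 := S.eq_of_read_lift hc (by omega) z hz S' hS hr
        have h2 := T.eq_of_read_lift hc (by omega) z hz T' hT hr
        cases h1
        cases h2
        rfl

end Independence

end PairFree

/-! ### The presented algebra and the conclusion -/

namespace PairFree

open Vertex Colouring

section Presentation

variable {n : ℕ}

/-- The generators of the pair-free Temperley–Lieb algebra. -/
noncomputable def PFTLD.b (i : Fin n) : PFTLD n :=
  RingQuot.mkAlgHom ℤ[X] (PFTLD.Rel n) (TLD.b i)

theorem coxeterGraphD_adj {i j : Fin n} (h : i.val < j.val) :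
    (coxeterGraphD n).Adj i j ↔ (1 ≤ i.val ∧ j.val = i.val + 1) ∨ (i.val = 0 ∧ j.val = 2) := by
  rw [coxeterGraphD, SimpleGraph.fromRel_adj]
  constructor
  · rintro ⟨-, h | h⟩
    · exact h
    · omega
  · intro h'
    exact ⟨fun he => by rw [he] at h; omega, Or.inl h'⟩

/-- The quotient map from the free algebra. -/
noncomputable def PFTLD.proj (n : ℕ) : FreeAlgebra ℤ[X] (Fin n) →ₐ[ℤ[X]] PFTLD n :=
  AlgHom.comp (A := FreeAlgebra ℤ[X] (Fin n)) (B := TLD n) (C := PFTLD n)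
    (RingQuot.mkAlgHom ℤ[X] (PFTLD.Rel n)) (TLD.mk n)

theorem PFTLD.proj_ι (i : Fin n) : PFTLD.proj n (FreeAlgebra.ι ℤ[X] i) = PFTLD.b i := rfl

theorem PFTLD.proj_surjective : Function.Surjective (PFTLD.proj n) :=
  (RingQuot.mkAlgHom_surjective ℤ[X] (PFTLD.Rel n)).comp
    (RingQuot.mkAlgHom_surjective ℤ[X] (TLD.Rel n))

theorem PFTLD.proj_rel {x y : FreeAlgebra ℤ[X] (Fin n)} (h : TLD.Rel n x y) :
    PFTLD.proj n x = PFTLD.proj n y :=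
  congrArg (RingQuot.mkAlgHom ℤ[X] (PFTLD.Rel n)) (RingQuot.mkAlgHom_rel ℤ[X] h)

theorem PFTLD.b_sq (i : Fin n) : (PFTLD.b i * PFTLD.b i : PFTLD n) = (X : ℤ[X]) • PFTLD.b i := by
  simpa only [map_mul, map_smul, PFTLD.proj_ι] using PFTLD.proj_rel (.sq i)

theorem PFTLD.b_comm {i j : Fin n} (h : ¬ (coxeterGraphD n).Adj i j) :
    (PFTLD.b i * PFTLD.b j : PFTLD n) = PFTLD.b j * PFTLD.b i := by
  simpa only [map_mul, PFTLD.proj_ι] using PFTLD.proj_rel (.comm i j h)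

theorem PFTLD.b_braid {i j : Fin n} (h : (coxeterGraphD n).Adj i j) :
    (PFTLD.b i * PFTLD.b j * PFTLD.b i : PFTLD n) = PFTLD.b i := by
  simpa only [map_mul, PFTLD.proj_ι] using PFTLD.proj_rel (.braid i j h)

theorem PFTLD.b_pair {i j : Fin n} (hi : i.val = 1) (hj : j.val = 0) :
    (PFTLD.b i * PFTLD.b j : PFTLD n) = 0 := by
  have h := RingQuot.mkAlgHom_rel ℤ[X] (PFTLD.Rel.pair i j hi hj)
  rw [map_mul, map_zero] at h
  exact h

theorem PFTLD.exists_lift {B : Type*} [Ring B] [Algebra ℤ[X] B] (β : Fin n → B)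
    (hsq : ∀ i, β i * β i = (X : ℤ[X]) • β i)
    (hcomm : ∀ i j, ¬ (coxeterGraphD n).Adj i j → β i * β j = β j * β i)
    (hbraid : ∀ i j, (coxeterGraphD n).Adj i j → β i * β j * β i = β i)
    (hpair : ∀ i j : Fin n, i.val = 1 → j.val = 0 → β i * β j = 0) :
    ∃ φ : PFTLD n →ₐ[ℤ[X]] B, ∀ i, φ (PFTLD.b i) = β i := by
  have h1 : ∀ ⦃x y⦄, TLD.Rel n x y →
      FreeAlgebra.lift ℤ[X] β x = FreeAlgebra.lift ℤ[X] β y := by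
    rintro _ _ (i | ⟨i, j, h⟩ | ⟨i, j, h⟩)
    · simpa using hsq i
    · simpa using hcomm i j h
    · simpa using hbraid i j h
  let φ₁ : TLD n →ₐ[ℤ[X]] B := RingQuot.liftAlgHom ℤ[X] ⟨FreeAlgebra.lift ℤ[X] β, h1⟩
  have hφ₁ : ∀ i, φ₁ (TLD.b i) = β i := by
    intro i
    have := RingQuot.liftAlgHom_mkAlgHom_apply ℤ[X] (FreeAlgebra.lift ℤ[X] β) h1
      (FreeAlgebra.ι ℤ[X] i)
    rw [FreeAlgebra.lift_ι_apply] at this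
    exact this
  have h2 : ∀ ⦃x y⦄, PFTLD.Rel n x y → φ₁ x = φ₁ y := by
    rintro _ _ ⟨i, j, hi, hj⟩
    rw [map_mul, map_zero, hφ₁, hφ₁, hpair i j hi hj]
  refine ⟨RingQuot.liftAlgHom ℤ[X] ⟨φ₁, h2⟩, fun i => ?_⟩
  rw [← hφ₁ i]
  exact RingQuot.liftAlgHom_mkAlgHom_apply ℤ[X] φ₁ h2 (TLD.b i)

/-- The generators as a sequence. -/
noncomputable def PFTLD.seq (n : ℕ) (i : ℕ) : PFTLD n :=
  if h : i < n then PFTLD.b ⟨i, h⟩ else 0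

theorem PFTLD.seq_of_lt {i : ℕ} (h : i < n) : PFTLD.seq n i = PFTLD.b ⟨i, h⟩ := dif_pos h

theorem PFTLD.seq_relations (hn : 3 ≤ n) : Relations (X : ℤ[X]) n (PFTLD.seq n) := by
  constructor
  · intro i hi
    rw [seq_of_lt hi, b_sq]
  · intro i j hij hj h
    rw [seq_of_lt hj, seq_of_lt (show i < n by omega)]
    refine b_comm ?_
    rw [coxeterGraphD_adj (show i < j by omega)]
    simp only
    omega
  · rw [seq_of_lt (show 0 < n by omega), seq_of_lt (show 1 < n by omega), b_comm,
      b_pair rfl rfl]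
    rw [coxeterGraphD_adj (by simp)]
    simp
  · rw [seq_of_lt (show 0 < n by omega), seq_of_lt (show 1 < n by omega), b_pair rfl rfl]
  · intro i hi hin
    rw [seq_of_lt hin, seq_of_lt (show i < n by omega)]
    refine b_braid ((coxeterGraphD_adj (by simp)).2 (Or.inl ⟨hi, rfl⟩))
  · intro i hi hin
    rw [seq_of_lt hin, seq_of_lt (show i < n by omega)]
    refine b_braid ((coxeterGraphD_adj (by simp)).2 (Or.inl ⟨hi, rfl⟩)).symm
  · rw [seq_of_lt (show 0 < n by omega), seq_of_lt (show 2 < n by omega)]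
    exact b_braid ((coxeterGraphD_adj (by simp)).2 (Or.inr ⟨rfl, rfl⟩))
  · rw [seq_of_lt (show 0 < n by omega), seq_of_lt (show 2 < n by omega)]
    exact b_braid ((coxeterGraphD_adj (by simp)).2 (Or.inr ⟨rfl, rfl⟩)).symm

theorem PFTLD.induction {P : PFTLD n → Prop} (halg : ∀ r, P (algebraMap ℤ[X] _ r))
    (hb : ∀ i, P (PFTLD.b i)) (hmul : ∀ x y, P x → P y → P (x * y))
    (hadd : ∀ x y, P x → P y → P (x + y)) (x : PFTLD n) : P x := by
  obtain ⟨x, rfl⟩ := PFTLD.proj_surjective x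
  induction x using FreeAlgebra.induction with
  | grade0 r => rw [AlgHom.commutes]; exact halg r
  | grade1 i => exact hb i
  | mul x y hx hy => rw [map_mul]; exact hmul _ _ hx hy
  | add x y hx hy => rw [map_add]; exact hadd _ _ hx hy

theorem PFTLD.level_eq_top (hn : 2 ≤ n) : level ℤ[X] (PFTLD.seq n) n = ⊤ := by
  rw [eq_top_iff]
  rintro x -
  refine PFTLD.induction (P := fun x => x ∈ level ℤ[X] (PFTLD.seq n) n)
    (fun r => Subalgebra.algebraMap_mem _ r) ?_ (fun x y => mul_mem) (fun x y => add_mem) x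
  intro i
  have := mem_level (R := ℤ[X]) (PFTLD.seq n) (n := n) (i := i) (by have := i.2; omega)
  rwa [PFTLD.seq_of_lt i.2] at this

-- Every defining relation is preserved by reversing words (the pair relation because `b_1` and
-- `b_{1̄}` commute), so the generators also define a homomorphism to the opposite algebra.
open MulOpposite in
theorem PFTLD.exists_star (n : ℕ) : ∃ star : PFTLD n →ₗ[ℤ[X]] PFTLD n,
    (∀ a, star (star a) = a) ∧ (∀ a b, star (a * b) = star b * star a) ∧
      ∀ i, star (PFTLD.b i) = PFTLD.b i := by
  obtain ⟨φ, hφ⟩ := PFTLD.exists_lift (n := n) (fun i => op (PFTLD.b i))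
    (fun i => by rw [← op_mul, PFTLD.b_sq, op_smul])
    (fun i j h => by rw [← op_mul, ← op_mul, PFTLD.b_comm h])
    (fun i j h => by rw [← op_mul, ← op_mul, ← mul_assoc, PFTLD.b_braid h])
    (fun i j hi hj => by
      rw [← op_mul, ← PFTLD.b_comm, PFTLD.b_pair hi hj, op_zero]
      rw [SimpleGraph.adj_comm, coxeterGraphD_adj (by omega)]
      omega)
  let star : PFTLD n →ₗ[ℤ[X]] PFTLD n :=
    (opLinearEquiv ℤ[X]).symm.toLinearMap ∘ₗ φ.toLinearMap
  have hs : ∀ a, star a = unop (φ a) := fun a => rfl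
  have hmul : ∀ a b, star (a * b) = star b * star a := fun a b => by simp [hs]
  have hb : ∀ i, star (PFTLD.b i) = PFTLD.b i := fun i => by rw [hs, hφ, unop_op]
  refine ⟨star, ?_, hmul, hb⟩
  refine PFTLD.induction ?_ ?_ ?_ ?_
  · intro r; simp [hs]
  · intro i; rw [hb, hb]
  · intro x y hx hy; rw [hmul, hmul, hx, hy]
  · intro x y hx hy; rw [map_add, map_add, hx, hy]

/-- Functions on colourings with `d` pairs of colours represent the pair-free Temperley–Lieb algebra
at any specialization of the parameter to `2 * d`. -/
theorem PFTLD.exists_representation (n d : ℕ) {Q : Type*} [CommRing Q] [Algebra ℤ[X] Q]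
    (hQ : algebraMap ℤ[X] Q X = ((2 * d : ℕ) : Q)) :
    ∃ ρ : PFTLD n →ₐ[ℤ[X]] Module.End ℤ[X] (Colouring d → Q),
      ∀ i < n, ρ (PFTLD.seq n i) = gen ℤ[X] i := by
  have hg := gen_relations ℤ[X] (Q := Q) (d := d) (n + 3)
  have hwlog : ∀ {P : Fin n → Fin n → Prop}, (∀ i, P i i) → (∀ i j, i.val < j.val → P i j) →
      (∀ i j, i.val < j.val → P j i) → ∀ i j, P i j := by
    intro P h1 h2 h3 i j
    rcases lt_trichotomy i.val j.val with h | h | h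
    · exact h2 i j h
    · rw [Fin.ext h]; exact h1 j
    · exact h3 j i h
  have hcomm : ∀ i j : Fin n, i.val < j.val → ¬ (coxeterGraphD n).Adj i j →
      (gen ℤ[X] i.val * gen ℤ[X] j.val : Module.End ℤ[X] (Colouring d → Q)) =
        gen ℤ[X] j.val * gen ℤ[X] i.val := by
    intro i j hij h
    rw [coxeterGraphD_adj hij] at h
    by_cases h01 : i.val = 0 ∧ j.val = 1
    · rw [h01.1, h01.2, hg.zero_one, hg.one_zero]
    · exact hg.comm _ _ (by omega) (by omega) (by omega)
  suffices h : ∃ ρ : PFTLD n →ₐ[ℤ[X]] Module.End ℤ[X] (Colouring d → Q),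
      ∀ i : Fin n, ρ (PFTLD.b i) = gen ℤ[X] i.val by
    obtain ⟨ρ, hρ⟩ := h
    exact ⟨ρ, fun i hi => by rw [PFTLD.seq_of_lt hi, hρ]⟩
  refine PFTLD.exists_lift (fun i : Fin n => gen ℤ[X] i.val) ?_ ?_ ?_ ?_
  · intro i
    rw [hg.sq i.val (by omega)]
    ext f x
    rw [LinearMap.smul_apply, LinearMap.smul_apply, Pi.smul_apply, Pi.smul_apply, Algebra.smul_def,
      Algebra.smul_def, hQ, map_natCast]
  · refine hwlog (fun i _ => rfl) hcomm fun i j hij h => ?_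
    rw [SimpleGraph.adj_comm] at h
    exact (hcomm i j hij h).symm
  · refine hwlog (fun i h => absurd h (SimpleGraph.irrefl _)) (fun i j hij h => ?_)
      fun i j hij h => ?_
    · rw [coxeterGraphD_adj hij] at h
      rcases h with ⟨h1, h2⟩ | ⟨h1, h2⟩
      · simp only [h2]; exact hg.braid _ h1 (by omega)
      · simp only [h1, h2]; exact hg.zero_two
    · rw [SimpleGraph.adj_comm, coxeterGraphD_adj hij] at h
      rcases h with ⟨h1, h2⟩ | ⟨h1, h2⟩
      · simp only [h2]; exact hg.braid' _ h1 (by omega)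
      · simp only [h1, h2]; exact hg.two_zero
  · intro i j hi hj
    simp only [hi, hj, hg.one_zero]

theorem PFTLD.linearIndependent_cell (hn : 3 ≤ n) {star : PFTLD n →ₗ[ℤ[X]] PFTLD n}
    (star_star : ∀ a, star (star a) = a)
    (star_mul : ∀ a b, star (a * b) = star b * star a)
    (star_b : ∀ i < n, star (PFTLD.seq n i) = PFTLD.seq n i) :
    LinearIndependent ℤ[X] (cell (PFTLD.seq n) n star) := by
  classical
  rw [linearIndependent_iff']
  intro s g hs
  by_contra! hne
  obtain ⟨i, hi, hgi⟩ := hne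
  -- Among the nonzero coefficients choose one with the most through strands; it will be shown to
  -- have infinitely many roots.
  obtain ⟨m, hm, hmax⟩ := Finset.exists_max_image (s.filter fun j => g j ≠ 0)
    (fun j => j.1.rank) ⟨i, Finset.mem_filter.2 ⟨hi, hgi⟩⟩
  rw [Finset.mem_filter] at hm
  have hroot : ∀ d, 2 * n < d → (g m).IsRoot (2 * d : ℕ) := by
    intro d hd
    -- In the quotient by `X - 2 * d` the parameter becomes `2 * d`, and a polynomial vanishes there
    -- exactly when `2 * d` is a root.
    let I : Ideal ℤ[X] := Ideal.span {X - C ((2 * d : ℕ) : ℤ)}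
    have hQ : algebraMap ℤ[X] (ℤ[X] ⧸ I) X = ((2 * d : ℕ) : ℤ[X] ⧸ I) := by
      rw [← map_natCast (algebraMap ℤ[X] (ℤ[X] ⧸ I)), ← sub_eq_zero, ← map_sub]
      refine Ideal.Quotient.eq_zero_iff_mem.2 (Ideal.subset_span ?_)
      simp
    obtain ⟨ρ, hρ⟩ := PFTLD.exists_representation n d hQ
    have h := (PFTLD.seq_relations hn).smul_one_eq_zero star_star star_mul star_b ρ hρ hd s g hs
      hm.1 fun j hj hgj => hmax j (Finset.mem_filter.2 ⟨hj, hgj⟩)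
    rw [← Algebra.algebraMap_eq_smul_one] at h
    rw [← dvd_iff_isRoot]
    exact Ideal.mem_span_singleton.1 (Ideal.Quotient.eq_zero_iff_mem.1 h)
  refine hm.2 (eq_zero_of_infinite_isRoot _ ?_)
  refine Set.infinite_of_injective_forall_mem
    (f := fun k : ℕ => ((2 * (2 * n + 1 + k) : ℕ) : ℤ)) ?_ fun k => hroot _ (by omega)
  intro k k' h
  simp only [Nat.cast_inj] at h
  omega

end Presentation

end PairFree

theorem mainTheorem2 (n : ℕ) (hn : 4 ≤ n) : IsCellular ℤ[X] (PFTLD n) := by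
  obtain ⟨star, star_star, star_mul, star_b⟩ := PairFree.PFTLD.exists_star n
  have star_seq : ∀ i < n, star (PairFree.PFTLD.seq n i) = PairFree.PFTLD.seq n i := fun i hi => by
    rw [PairFree.PFTLD.seq_of_lt hi, star_b]
  exact (PairFree.PFTLD.seq_relations (by omega)).isCellular (by omega) star_star star_mul star_seq
    (PairFree.PFTLD.level_eq_top (by omega))
    (PairFree.PFTLD.linearIndependent_cell (by omega) star_star star_mul star_seq)
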